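/- Conventions. A Hopf Galois structure on a finite field extension $M/K$ is a $K$-Hopf algebra $H$ with a $K$-algebra homomorphism $\rho_H\colon H\to\operatorname{End}_K(M)$, $h\cdot x=\rho_H(h)(x)$, such that $h\cdot 1=\varepsilon(h)1$, $h\cdot(xy)=\sum (h_{(1)}\cdot x)(h_{(2)}\cdot y)$, and the map $M\otimes_K H\to\operatorname{End}_K(M)$, $m\otimes h\mapsto (x\mapsto m\,(h\cdot x))$, is bijective. $M/K$ is Hopf Galois if it has such a structure. Hopf Galois structures are identified when they are related by an isomorphism of Hopf algebras compatible with the actions. Let $L/K$ be a finite Galois extension with group $G=J\rtimes G'$ ($J$ normal in $G$, $G'$ a complement of $J$), and put $E=L^{G'}$, $F=L^{J}$. Let $\lambda_c\colon G\to\mathrm{Perm}(J)$ be the action of $G$ by left translation on $G/G'\cong J$, and let $\lambda'\colon G'\to\mathrm{Perm}(G')$ and $\lambda\colon G\to\mathrm{Perm}(G)$ be the left regular representations. By the Greither–Pareigis correspondence, the Hopf Galois structures on $E/K$, on $L/E$ and on $L/K$ correspond to the regular subgroups $N_1\le\mathrm{Perm}(J)$, $N_2\le\mathrm{Perm}(G')$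 and $N\le\mathrm{Perm}(G)$ normalized by $\lambda_c(G)$, $\lambda'(G')$ and $\lambda(G)$, respectively; the Hopf algebras are $L[N_1]^G$, $L[N_2]^{G'}$ and $L[N]^G$ (the groups act on $L$ by Galois automorphisms and on $N_1,N_2,N$ by conjugation through $\lambda_c,\lambda',\lambda$), acting by $\left(\sum_n c_n n\right)\cdot x=\sum_n c_n\,n^{-1}(1)(x)$. The structure on $L/K$ induced from $H_1$ on $E/K$ and $H_2$ on $L/E$, corresponding to $N_1$ and $N_2$, is the one corresponding to $N=\iota(N_1\times N_2)$, where $\iota(\varphi,\psi)(\sigma\tau)=\varphi(\sigma)\psi(\tau)$ for $\sigma\in J$, $\tau\in G'$. **Theorem.** With this notation: 1. $E/K$ and $F/K$ are Hopf Galois extensions. 2. $L=EF$ and $E\cap F=K$. 3. $E$ and $F$ are linearly disjoint over $K$; thus $E\otimes_K F\to L$, $\alpha\otimes z\mapsto\alpha z$, is an isomorphism. Let $H_1$ and $H_2$ be Hopf Galois structures on $E/K$ and on $L/E$. Then the induced Hopf Galois structure $H$ on $L/K$ exists, and: 4. There is a unique Hopf Galois structure $\overline H$ on $F/K$ such that $H_2\cong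 E\otimes_K\overline H$ as Hopf Galois structures on $L/E$, where $(a\otimes h)\cdot(\alpha z)=a\alpha\,(h\cdot z)$ for $a,\alpha\in E$, $h\in\overline H$, $z\in F$; and $H\cong H_1\otimes_K\overline H$ as $K$-Hopf algebras. 5. Under this isomorphism and $L=E\otimes_K F$, the action of $H$ on $L$ is the Kronecker product of the actions of $H_1$ on $E$ and of $\overline H$ on $F$: $(w\otimes\eta)\cdot(\alpha\otimes z)=(w\cdot\alpha)\otimes(\eta\cdot z)$ for $w\in H_1$, $\eta\in\overline H$, $\alpha\in E$, $z\in F$. -/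

import Mathlib

open scoped TensorProduct

universe u w w₁ w₂ w₃ w₄

noncomputable section

/-- The `K`-linear map `j : L ⊗[K] H → End_K(L)`, `j (l ⊗ h) x = l * ρ h x`, attached to a
representation `ρ` of a `K`-algebra `H` on `L`. -/
def galoisMap {K L H : Type*} [Field K] [Field L] [Algebra K L] [Ring H] [Algebra K H]
    (ρ : H →ₐ[K] Module.End K L) : L ⊗[K] H →ₗ[K] Module.End K L :=
  TensorProduct.lift
    ((LinearMap.mul K (Module.End K L)).compl₁₂ (Algebra.lmul K L).toLinearMap ρ.toLinearMap)

/-- A Hopf Galois structure on a field extension `L/K` : a `K`-Hopf algebra `H` together with a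
Hopf action of `H` on `L` (that is, `L` is an `H`-module algebra) such that the map
`L ⊗[K] H → End_K(L)` is bijective. -/
structure HopfGaloisStructure (K L : Type*) [Field K] [Field L] [Algebra K L] where
  /-- The underlying Hopf algebra. -/
  H : Type w
  [ring : Ring H]
  [hopf : HopfAlgebra K H]
  /-- The action of the Hopf algebra on `L`. -/
  act : H →ₐ[K] Module.End K L
  /-- `h · 1 = ε(h) 1` -/
  act_one : ∀ h : H, act h 1 = algebraMap K L (Coalgebra.counit h)
  /-- `h · (x y) = ∑ (h₁ · x) (h₂ · y)` where `Δ(h) = ∑ h₁ ⊗ h₂` -/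
  act_mul : ∀ (h : H) (x y : L), act h (x * y) =
    LinearMap.mul' K L
      (TensorProduct.map (act.toLinearMap.flip x) (act.toLinearMap.flip y)
        (Coalgebra.comul (R := K) h))
  bijective : Function.Bijective (galoisMap act)

attribute [instance] HopfGaloisStructure.ring HopfGaloisStructure.hopf

/-- The extension `L/K` is Hopf Galois. -/
def IsHopfGalois (K : Type*) (L : Type w) [Field K] [Field L] [Algebra K L] : Prop :=
  Nonempty (HopfGaloisStructure.{w} K L)

/-- Two Hopf Galois structures on `L/K` are isomorphic (i.e. they are the same structure) if there
is an isomorphism of Hopf algebras which is compatible with the actions. -/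
def HopfGaloisStructure.IsIso {K L : Type*} [Field K] [Field L] [Algebra K L]
    (S T : HopfGaloisStructure K L) : Prop :=
  ∃ e : S.H ≃ₐc[K] T.H, ∀ (h : S.H) (x : L), T.act (e h) x = S.act h x

section GreitherPareigis

/-- A group of permutations is regular if it is simply transitive. -/
def IsRegularPermGroup {X : Type*} (N : Subgroup (Equiv.Perm X)) : Prop :=
  ∀ x y : X, ∃! n : N, (n : Equiv.Perm X) x = y

/-- The subset `L[N]^Γ` of the group algebra `L[N]`, where `N` is a group of permutations of `X`
and `Γ` acts on the coefficients through its action on `L` and on `N` by conjugation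
through `lam : Γ → Perm X`: the element `∑ cₙ n` is fixed when `c_{lam(γ) n lam(γ)⁻¹} = γ(cₙ)` for
all `γ` and `n`. -/
def fixedGroupAlgebra (L : Type*) [Field L] {Γ : Type*} [Group Γ] [MulSemiringAction Γ L]
    {X : Type*} (lam : Γ →* Equiv.Perm X) (N : Subgroup (Equiv.Perm X)) :
    Set (MonoidAlgebra L N) :=
  {a | ∀ (γ : Γ) (n n' : N), (n' : Equiv.Perm X) = lam γ * n * (lam γ)⁻¹ →
    a.coeff n' = γ • a.coeff n}

/-- The Greither-Pareigis correspondence. Here `L/K` is a Galois extension with group `Γ`, `M` is an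
intermediate field, and `X` is a set of representatives in `Γ` (via `rep : X → Γ`) of the left
cosets of `Gal(L/M)`, on which `Γ` acts by left translation of cosets through `lam`; the point `1`
of `X` represents the trivial coset.

The Hopf Galois structure `S` on `M/K` corresponds to the subgroup `N` of `Perm X` if
`N` is regular and normalized by `lam(Γ)`, and `S` is the `K`-Hopf algebra `L[N]^Γ` acting by
`(∑ cₙ n) · x = ∑ cₙ (n⁻¹(1))(x)`. The identification of `S.H` with `L[N]^Γ` as a `K`-Hopf algebra
(the structure of `L[N]^Γ` being the one induced by `L[N] = L ⊗[K] L[N]^Γ`)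
is an isomorphism of `L`-Hopf algebras `L ⊗[K] S.H ≃ L[N]` that carries `S.H` onto `L[N]^Γ`. -/
structure HopfGaloisStructure.CorrespondsTo {K M L : Type*} [Field K] [Field M] [Field L]
    [Algebra K M] [Algebra K L] [Algebra M L] (S : HopfGaloisStructure K M)
    {Γ : Type*} [Group Γ] [MulSemiringAction Γ L] {X : Type*} [One X]
    (lam : Γ →* Equiv.Perm X) (rep : X → Γ) (N : Subgroup (Equiv.Perm X)) : Prop where
  regular : IsRegularPermGroup N
  normalized : lam.range ≤ Subgroup.normalizer (N : Set (Equiv.Perm X))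
  exists_equiv : ∃ Φ : (L ⊗[K] S.H) ≃ₐc[L] MonoidAlgebra L N,
    Set.range (fun h : S.H => Φ (1 ⊗ₜ[K] h)) = fixedGroupAlgebra L lam N ∧
    ∀ (h : S.H) (x : M), algebraMap M L (S.act h x) =
      (Φ (1 ⊗ₜ[K] h)).coeff.sum fun n c =>
        c * (rep ((n : Equiv.Perm X)⁻¹ 1) • algebraMap M L x)

end GreitherPareigis

section Induction

variable {G : Type*} [Group G] {J G' : Subgroup G}

/-- For `G = J ⋊ G'`, the action of `G` on `J` by left translation of left cosets of `G'`, where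
`J` is identified with `G/G'` by `σ ↦ σ G'`. -/
def cosetAction (hc : J.IsComplement' G') : G →* Equiv.Perm J :=
  (Equiv.permCongrHom (Subgroup.IsComplement.leftQuotientEquiv hc)).toMonoidHom.comp
    (MulAction.toPermHom G (G ⧸ G'))

/-- The embedding `Perm(J) × Perm(G') → Perm(G)`, `(φ, ψ) ↦ (σ τ ↦ φ(σ) ψ(τ))`, for
`G = J ⋊ G'`. -/
def permProd (hc : J.IsComplement' G') :
    Equiv.Perm J × Equiv.Perm G' →* Equiv.Perm G :=
  (Equiv.permCongrHom (Equiv.ofBijective _ hc)).toMonoidHom.comp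
    { toFun := fun p => Equiv.prodCongr p.1 p.2
      map_one' := rfl
      map_mul' := fun _ _ => rfl }

end Induction

section Structures

variable {K L : Type*} [Field K] [Field L] [Algebra K L]

/-- Let `L/K` be Galois with group `G = J ⋊ G'` and `E = L^{G'}`. The Hopf Galois structure `S` on
`L/K` is induced from `S₁` on `E/K` and `S₂` on `L/E`: `S₁` corresponds to a subgroup `N₁` of
`Perm(J)`, `S₂` to a subgroup `N₂` of `Perm(G')`, and `S` to the image of `N₁ × N₂` in `Perm(G)`. -/
def HopfGaloisStructure.IsInduced {J G' : Subgroup Gal(L/K)} {E : IntermediateField K L}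
    (S : HopfGaloisStructure K L) (hc : J.IsComplement' G')
    (S₁ : HopfGaloisStructure K E) (S₂ : HopfGaloisStructure E L) : Prop :=
  ∃ (N₁ : Subgroup (Equiv.Perm J)) (N₂ : Subgroup (Equiv.Perm G')),
    S₁.CorrespondsTo (L := L) (cosetAction hc) (fun σ : J => (σ : Gal(L/K))) N₁ ∧
    S₂.CorrespondsTo (L := L) (MulAction.toPermHom G' G') (fun τ : G' => τ) N₂ ∧
    S.CorrespondsTo (L := L) (MulAction.toPermHom Gal(L/K) Gal(L/K)) (fun g : Gal(L/K) => g)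
      ((N₁.prod N₂).map (permProd hc))

/-- `S₂ = E ⊗[K] T` as Hopf Galois structures on `L/E`, where `T` is a Hopf Galois structure on
`F/K`: the Hopf algebra is the base change to `E`, acting on `L = E F` by
`(a ⊗ h) · (α z) = a α (h · z)`. -/
def HopfGaloisStructure.IsBaseChange {E F : IntermediateField K L}
    (T : HopfGaloisStructure K F) (S₂ : HopfGaloisStructure E L) : Prop :=
  ∃ e : (E ⊗[K] T.H) ≃ₐc[E] S₂.H, ∀ (a : E) (h : T.H) (α : E) (z : F),
    S₂.act (e (a ⊗ₜ[K] h)) ((α : L) * (z : L)) = (a : L) * (α : L) * (T.act h z : L)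

/-- The Kronecker product (tensor product) `A₁ ⊗ A₂ → End_K(V₁ ⊗ V₂)` of two representations. -/
def kroneckerRep {A₁ A₂ V₁ V₂ : Type*} [Ring A₁] [Algebra K A₁] [Ring A₂] [Algebra K A₂]
    [AddCommGroup V₁] [Module K V₁] [AddCommGroup V₂] [Module K V₂]
    (ρ₁ : A₁ →ₐ[K] Module.End K V₁) (ρ₂ : A₂ →ₐ[K] Module.End K V₂) :
    A₁ ⊗[K] A₂ →ₐ[K] Module.End K (V₁ ⊗[K] V₂) :=
  (Module.endTensorEndAlgHom (R := K) (S := K) (A := K) (M := V₁) (N := V₂)).comp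
    (Algebra.TensorProduct.map ρ₁ ρ₂)

/-- The canonical map `E ⊗[K] F → L`, `α ⊗ z ↦ α z`. -/
def mulTensor (E F : IntermediateField K L) : E ⊗[K] F →ₐ[K] L :=
  Algebra.TensorProduct.productMap E.val F.val

/-- `S` is the tensor product of `S₁` and `T`: the Hopf algebra of `S` is `S₁.H ⊗[K] T.H`, and its
action on `L = E ⊗[K] F` is the Kronecker product of the actions of `S₁.H` on `E` and `T.H`
on `F`. -/
def HopfGaloisStructure.IsTensorProduct {E F : IntermediateField K L}
    (S : HopfGaloisStructure K L) (S₁ : HopfGaloisStructure K E) (T : HopfGaloisStructure K F) :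
    Prop :=
  ∃ e : (S₁.H ⊗[K] T.H) ≃ₐc[K] S.H, ∀ (h : S₁.H ⊗[K] T.H) (t : E ⊗[K] F),
    S.act (e h) (mulTensor E F t) = mulTensor E F (kroneckerRep S₁.act T.act h t)

end Structures

end

set_option linter.unusedSectionVars false

/-! The field-theoretic part is Galois theory for `G = J ⋊ G'`: the subgroup fixing `EF` is `J ∩ G'
= 1`, an element of `E ∩ F` is fixed by `J` and `G'`, hence by `G`, and the degrees `|J|` and `|G'|`
multiply to `|G|`, which gives linear disjointness. `E/K` is Hopf Galois through the left
translations by `J`, a group normalized by the image of `G` because `J` is normal; `F/K` is Hopf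
Galois through the left translations of `G'`.

The rest is the Greither–Pareigis correspondence, organized around evaluation. An element `∑ l ⊗ h`
of `L ⊗ H` and a `γ` in the Galois group give the map `m ↦ ∑ l γ(h · m)` (`evalAt`). At `γ = 1` this
identifies `L ⊗ H` with the `K`-linear maps `M → L`, and the group-like elements with the
`K`-embeddings of `M`, that is, with the points of the coset space `X`. Hence the group-like
elements form a regular group of permutations of `X` (`exists_correspondsTo`). Conversely, to prove
that `H` corresponds to a given regular normalized `N` it is enough to find for every `n ∈ N` an
element of `L ⊗ H` that acts through `n` (`Represents`, `correspondsTo_of_represents`). A structure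
is determined by the image of `H` in `End_K(M)` (`isIso_of_forall_exists`), so `N` determines it
(`CorrespondsTo.isIso`).

For `H̄`, let `G` act on `G'` through `G → G/J ≅ G'`. The group `N₂` of `H₂` is normalized by this
action, so it also defines a structure on `F/K`, with Hopf algebra `L[N₂]^G ⊆ L[N₂]^{G'} = H₂`;
counting dimensions, its base change to `E` is all of `H₂` (`exists_isBaseChange`). Finally `H₁ ⊗
H̄` acts on `L = E ⊗ F` by the Kronecker product. Since `στ(αz) = σ(α) τ(z)`, representatives of `φ
∈ N₁` and `ψ ∈ N₂` combine to a representative of `ι(φ, ψ)` (`tensorProduct_correspondsTo`). Thus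
`H₁ ⊗ H̄` corresponds to `ι(N₁ × N₂)`, as the induced structure does, and the two agree. -/

noncomputable section

/-! ### Spaces of functions that stay independent after extension of scalars -/

/-- The map `V ⊗ W → (X × Y → Q)` attached to two spaces of `Q`-valued functions. -/
def tensorEval {k Q V W X Y : Type*} [CommRing k] [CommRing Q] [Algebra k Q]
    [AddCommGroup V] [Module k V] [AddCommGroup W] [Module k W]
    (f : V →ₗ[k] X → Q) (g : W →ₗ[k] Y → Q) : V ⊗[k] W →ₗ[k] X × Y → Q :=
  TensorProduct.lift (LinearMap.mk₂ k (fun v w p => f v p.1 * g w p.2)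
    (by intros; ext; simp [add_mul]) (by intros; ext; simp)
    (by intros; ext; simp [mul_add]) (by intros; ext; simp))

@[simp] theorem tensorEval_tmul {k Q V W X Y : Type*} [CommRing k] [CommRing Q] [Algebra k Q]
    [AddCommGroup V] [Module k V] [AddCommGroup W] [Module k W]
    (f : V →ₗ[k] X → Q) (g : W →ₗ[k] Y → Q) (v : V) (w : W) (p : X × Y) :
    tensorEval f g (v ⊗ₜ w) p = f v p.1 * g w p.2 := rfl

/-- A `k`-linear map `f : V → (X → Q)` is base-injective if its `Q`-linear extension to `Q ⊗ V` is
injective; that is, `k`-linearly independent vectors have `Q`-linearly independent images. -/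
def IsBaseInjective {k Q V X : Type*} [Field k] [Field Q] [Algebra k Q]
    [AddCommGroup V] [Module k V] (f : V →ₗ[k] X → Q) : Prop :=
  Function.Injective (f.liftBaseChange Q)

section

variable {k Q V W X Y : Type*} [Field k] [Field Q] [Algebra k Q]
  [AddCommGroup V] [Module k V] [AddCommGroup W] [Module k W]
  {f : V →ₗ[k] X → Q} {g : W →ₗ[k] Y → Q}

theorem isBaseInjective_iff_linearIndependent {ι : Type*} (b : Module.Basis ι k V) :
    IsBaseInjective f ↔ LinearIndependent Q (fun i => f (b i)) := by
  have h : (fun i => f (b i)) = (f.liftBaseChange Q) ∘ (b.baseChange Q) := by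
    ext i; simp
  rw [h, IsBaseInjective]
  constructor
  · intro hf
    exact (b.baseChange Q).linearIndependent.map' _ (LinearMap.ker_eq_bot.2 hf)
  · intro hl
    rw [← LinearMap.ker_eq_bot, LinearMap.ker_eq_bot']
    intro m hm
    rw [← (b.baseChange Q).linearCombination_repr m, Finsupp.apply_linearCombination] at hm
    have := (linearIndependent_iff.1 hl) _ hm
    simpa using this

theorem IsBaseInjective.injective (hf : IsBaseInjective f) : Function.Injective f := by
  rw [← LinearMap.ker_eq_bot, LinearMap.ker_eq_bot']
  intro v hv
  let b := Module.Basis.ofVectorSpace k V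
  have hl := (isBaseInjective_iff_linearIndependent b).1 hf
  have hl' : LinearIndependent k (fun i => f (b i)) :=
    hl.restrict_scalars (by
      intro x y hxy
      simpa [Algebra.smul_def] using hxy)
  rw [← b.linearCombination_repr v, Finsupp.apply_linearCombination] at hv
  have := (linearIndependent_iff.1 hl') _ hv
  simpa using this

/-- This is the tool that lets identities in a tensor product be checked on values;
comultiplications are compared in this way throughout. -/
theorem IsBaseInjective.tensorEval (hf : IsBaseInjective f) (hg : IsBaseInjective g) :
    IsBaseInjective (tensorEval f g) := by
  let b := Module.Basis.ofVectorSpace k V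
  let c := Module.Basis.ofVectorSpace k W
  rw [isBaseInjective_iff_linearIndependent (b.tensorProduct c)]
  have hb := (isBaseInjective_iff_linearIndependent b).1 hf
  have hc := (isBaseInjective_iff_linearIndependent c).1 hg
  rw [linearIndependent_iff'] at hb hc ⊢
  classical
  intro s a hs
  -- Extending the coefficients by zero to a rectangle containing the support separates the
  -- variables: independence of the second family is used with `x` fixed, then that of the first.
  let a' : _ → _ → Q := fun i j => if (i, j) ∈ s then a (i, j) else 0
  have key : ∀ i ∈ s.image Prod.fst, ∀ j ∈ s.image Prod.snd, a' i j = 0 := by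
    have h1 : ∀ x y, ∑ i ∈ s.image Prod.fst, ∑ j ∈ s.image Prod.snd,
        a' i j * (f (b i) x * g (c j) y) = 0 := by
      intro x y
      have := congrFun hs (x, y)
      simp only [Finset.sum_apply, Pi.smul_apply,
        smul_eq_mul, Pi.zero_apply] at this
      rw [← Finset.sum_product', ← this]
      symm
      apply Finset.sum_subset_zero_on_sdiff
      · intro p hp
        simp only [Finset.mem_product]
        exact ⟨Finset.mem_image_of_mem _ hp, Finset.mem_image_of_mem _ hp⟩
      · intro p hp
        simp [a', (Finset.mem_sdiff.1 hp).2]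
      · intro p hp
        rw [show b.tensorProduct c p = b p.1 ⊗ₜ c p.2 from b.tensorProduct_apply c p.1 p.2]
        simp [a', hp]
    intro i hi j hj
    have h2 : ∀ x, ∑ i ∈ s.image Prod.fst, a' i j * f (b i) x = 0 := by
      intro x
      refine hc (s.image Prod.snd) (fun j => ∑ i ∈ s.image Prod.fst, a' i j * f (b i) x) ?_ j hj
      ext y
      simp only [Finset.sum_apply, Pi.smul_apply, smul_eq_mul, Pi.zero_apply]
      rw [← h1 x y, Finset.sum_comm]
      refine Finset.sum_congr rfl fun j _ => ?_
      rw [Finset.sum_mul]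
      exact Finset.sum_congr rfl fun i _ => by ring
    refine hb (s.image Prod.fst) (fun i => a' i j) ?_ i hi
    ext x
    simpa using h2 x
  rintro ⟨i, j⟩ hij
  have := key i (Finset.mem_image_of_mem _ hij) j (Finset.mem_image_of_mem _ hij)
  simpa [a', hij] using this

theorem isBaseInjective_of_injective {f : V →ₗ[k] X → k} (hf : Function.Injective f) :
    IsBaseInjective f := by
  let b := Module.Basis.ofVectorSpace k V
  rw [isBaseInjective_iff_linearIndependent b]
  exact b.linearIndependent.map' f (LinearMap.ker_eq_bot.2 hf)

theorem IsBaseInjective.finrank_le [Finite X] (hf : IsBaseInjective f) :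
    Module.Finite k V ∧ Module.finrank k V ≤ Nat.card X := by
  have := Fintype.ofFinite X
  let b := Module.Basis.ofVectorSpace k V
  have hl := (isBaseInjective_iff_linearIndependent b).1 hf
  have := hl.finite
  have := Fintype.ofFinite (Module.Basis.ofVectorSpaceIndex k V)
  refine ⟨Module.Finite.of_basis b, ?_⟩
  rw [Module.finrank_eq_card_basis b, Nat.card_eq_fintype_card]
  simpa using hl.fintype_card_le_finrank

end

/-! ### Galois descent for semilinear actions -/

section Descent

variable {Γ K L V : Type*} [Field K] [Field L] [Algebra K L] [Group Γ]
  [MulSemiringAction Γ L] [hG : IsGaloisGroup Γ K L] [AddCommGroup V] [Module L V]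
  (T : Γ → V →+ V)

include hG in
theorem mem_range_algebraMap_of_smul_eq (l : L) (h : ∀ γ : Γ, γ • l = l) :
    l ∈ Set.range (algebraMap K L) :=
  hG.isInvariant.isInvariant l h

include hG in
theorem smul_algebraMap_eq (γ : Γ) (x : K) : γ • algebraMap K L x = algebraMap K L x := by
  have := hG.commutes
  exact smul_algebraMap γ x

include hG in
/-- Dedekind's independence of the elements of a Galois group. -/
theorem eq_zero_of_sum_mul_smul_eq_zero [Fintype Γ] (c : Γ → L)
    (h : ∀ l : L, ∑ γ, c γ * γ • l = 0) (γ : Γ) : c γ = 0 := by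
  have := hG.commutes
  have hinj : Function.Injective (fun γ : Γ => (MulSemiringAction.toAlgHom K L γ)) := by
    intro γ δ hγδ
    have := hG.faithful
    exact eq_of_smul_eq_smul (α := L) fun l => DFunLike.congr_fun hγδ l
  have := (linearIndependent_toLinearMap K L L).comp _ hinj
  rw [Fintype.linearIndependent_iff] at this
  refine this c ?_ γ
  ext l
  simpa using h l

include hG in
/-- A combination of linearly independent fixed vectors is fixed only if its coefficients are
in the ground field. -/
theorem mem_range_algebraMap_of_fixed {ι : Type*} {v : ι → V}
    (hT : ∀ γ (l : L) (w : V), T γ (l • w) = (γ • l) • T γ w)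
    (hv : LinearIndependent L v) (hfix : ∀ γ i, T γ (v i) = v i) (c : ι →₀ L)
    (hc : ∀ γ, T γ (c.sum fun i l => l • v i) = c.sum fun i l => l • v i) (i : ι) :
    c i ∈ Set.range (algebraMap K L) := by
  refine mem_range_algebraMap_of_smul_eq (Γ := Γ) _ fun γ => ?_
  have h := hc γ
  simp only [map_finsuppSum, hT, hfix] at h
  let c' : ι →₀ L := c.mapRange (fun l => γ • l) (smul_zero γ)
  have h' : Finsupp.linearCombination L v c' = Finsupp.linearCombination L v c := by
    rw [Finsupp.linearCombination_apply, Finsupp.linearCombination_apply, ← h,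
      Finsupp.sum_mapRange_index (by simp)]
  have := hv h'
  have := DFunLike.congr_fun this i
  simpa [c'] using this

include hG in
/-- Fixed vectors which are linearly independent over the ground field are linearly
independent. -/
theorem linearIndependent_of_fixed [Finite Γ] [Module K V] [IsScalarTower K L V] {ι : Type*}
    {v : ι → V} (hT : ∀ γ (l : L) (w : V), T γ (l • w) = (γ • l) • T γ w)
    (hfix : ∀ γ i, T γ (v i) = v i) (hv : LinearIndependent K v) : LinearIndependent L v := by
  have := Fintype.ofFinite Γ
  rw [linearIndependent_iff'] at hv ⊢
  intro s c hc i hi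
  -- Multiplying the relation by `l` and summing its Galois conjugates replaces the coefficients by
  -- traces, which lie in `K`.
  have htr : ∀ l : L, ∃ t : K, algebraMap K L t = ∑ γ : Γ, γ • l := fun l => by
    refine mem_range_algebraMap_of_smul_eq (Γ := Γ) _ fun γ => ?_
    rw [Finset.smul_sum]
    simp_rw [smul_smul]
    exact Fintype.sum_equiv (Equiv.mulLeft γ) _ _ fun _ => rfl
  choose tr htr using htr
  have key : ∀ l, tr (c i * l) = 0 := by
    intro l
    refine hv s (fun j => tr (c j * l)) ?_ i hi
    have h1 : ∀ γ : Γ, ∑ j ∈ s, (γ • (c j * l)) • v j = 0 := by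
      intro γ
      have := congrArg (fun w => T γ (l • w)) hc
      simpa [Finset.smul_sum, smul_smul, hT, hfix, mul_comm] using this
    have h2 := Finset.sum_congr rfl fun (γ : Γ) (_ : γ ∈ Finset.univ) => h1 γ
    rw [Finset.sum_comm] at h2
    rw [Finset.sum_const_zero] at h2
    rw [← h2]
    refine Finset.sum_congr rfl fun j _ => ?_
    rw [← Finset.sum_smul, ← htr, algebraMap_smul]
  -- The trace of `c i * l` vanishes for every `l`, so Dedekind's theorem kills each conjugate of `c
  -- i`.
  have h3 := eq_zero_of_sum_mul_smul_eq_zero (K := K) (L := L) (Γ := Γ) (fun γ => γ • c i)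
    (fun l => by simp_rw [← smul_mul', ← htr, key, map_zero]) 1
  simpa using h3

include hG in
/-- The fixed vectors of a semilinear action span. -/
theorem span_fixed_eq_top [Finite Γ] (hT : ∀ γ (l : L) (w : V), T γ (l • w) = (γ • l) • T γ w)
    (h1 : ∀ w, T 1 w = w) (hmul : ∀ γ δ w, T (γ * δ) w = T γ (T δ w)) :
    Submodule.span L {w | ∀ γ, T γ w = w} = ⊤ := by
  have := Fintype.ofFinite Γ
  by_contra hne
  obtain ⟨φ, hφ, hle⟩ := Submodule.exists_le_ker_of_lt_top _ (lt_top_iff_ne_top.2 hne)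
  refine hφ (LinearMap.ext fun w => ?_)
  -- The functional `φ` kills the fixed vectors `∑ γ, T γ (l • w)` for all `l`. Dedekind's theorem
  -- then gives `φ (T γ w) = 0` for each `γ`, in particular for `γ = 1`.
  have := eq_zero_of_sum_mul_smul_eq_zero (K := K) (L := L) (Γ := Γ) (fun γ => φ (T γ w))
    (fun l => by
      have hm : ∑ γ : Γ, T γ (l • w) ∈ LinearMap.ker φ := by
        refine hle (Submodule.subset_span fun γ => ?_)
        rw [map_sum]
        simp_rw [← hmul]
        exact Fintype.sum_equiv (Equiv.mulLeft γ) _ _ fun _ => rfl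
      simpa [hT, mul_comm] using hm) 1
  simpa [h1] using this

end Descent

/-- The functions take values in `Q`, so every `Q`-linear functional on `Q'` turns a relation over
`Q'` into one over `Q`. -/
theorem IsBaseInjective.extend {k Q Q' V X : Type*} [Field k] [Field Q] [Field Q'] [Algebra k Q]
    [Algebra k Q'] [Algebra Q Q'] [AddCommGroup V] [Module k V]
    {f : V →ₗ[k] X → Q} (hf : IsBaseInjective f) {f' : V →ₗ[k] X → Q'}
    (hff' : ∀ v x, f' v x = algebraMap Q Q' (f v x)) : IsBaseInjective f' := by
  let b := Module.Basis.ofVectorSpace k V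
  rw [isBaseInjective_iff_linearIndependent b] at hf ⊢
  rw [linearIndependent_iff'] at hf ⊢
  intro s c hc i hi
  rw [← Module.forall_dual_apply_eq_zero_iff Q]
  intro p
  refine hf s (fun j => p (c j)) ?_ i hi
  ext x
  have := congrArg p (congrFun hc x)
  simp only [Finset.sum_apply, Pi.smul_apply, hff', smul_eq_mul, Pi.zero_apply, map_zero,
    map_sum] at this ⊢
  rw [← this]
  refine Finset.sum_congr rfl fun j _ => ?_
  rw [mul_comm (c j), ← Algebra.smul_def, map_smul, smul_eq_mul, mul_comm]

/-! ### Hopf actions as spaces of functions -/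

/-- A representation viewed as a space of functions. -/
def repFun {K M H : Type*} [Field K] [Field M] [Algebra K M] [Ring H] [Algebra K H]
    (ρ : H →ₐ[K] Module.End K M) : H →ₗ[K] M → M where
  toFun h m := ρ h m
  map_add' h h' := by ext; simp
  map_smul' c h := by ext; simp

@[simp] theorem repFun_apply {K M H : Type*} [Field K] [Field M] [Algebra K M] [Ring H]
    [Algebra K H] (ρ : H →ₐ[K] Module.End K M) (h : H) (m : M) : repFun ρ h m = ρ h m := rfl

theorem repFun_liftBaseChange {K M H : Type*} [Field K] [Field M] [Algebra K M] [Ring H]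
    [Algebra K H] (ρ : H →ₐ[K] Module.End K M) (t : M ⊗[K] H) (m : M) :
    (repFun ρ).liftBaseChange M t m = galoisMap ρ t m := by
  induction t with
  | zero => simp
  | add a b ha hb => simp [ha, hb]
  | tmul a h => simp [galoisMap]

theorem galoisMap_injective_iff {K M H : Type*} [Field K] [Field M] [Algebra K M] [Ring H]
    [Algebra K H] (ρ : H →ₐ[K] Module.End K M) :
    Function.Injective (galoisMap ρ) ↔ IsBaseInjective (repFun ρ) := by
  rw [IsBaseInjective, injective_iff_map_eq_zero, injective_iff_map_eq_zero]
  refine forall_congr' fun t => imp_congr ?_ Iff.rfl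
  rw [LinearMap.ext_iff, funext_iff]
  exact forall_congr' fun m => by rw [repFun_liftBaseChange]; rfl

theorem galoisMap_bijective_of {K M H : Type*} [Field K] [Field M] [Algebra K M] [Ring H]
    [Algebra K H] [FiniteDimensional K M] [FiniteDimensional K H] (ρ : H →ₐ[K] Module.End K M)
    (hρ : IsBaseInjective (repFun ρ)) (hH : Module.finrank K H = Module.finrank K M) :
    Function.Bijective (galoisMap ρ) := by
  have hinj := (galoisMap_injective_iff ρ).2 hρ
  refine ⟨hinj, (LinearMap.injective_iff_surjective_of_finrank_eq_finrank ?_).1 hinj⟩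
  rw [Module.finrank_tensorProduct, Module.finrank_linearMap, hH]

namespace HopfGaloisStructure

variable {K M : Type*} [Field K] [Field M] [Algebra K M] (S : HopfGaloisStructure K M)

theorem isBaseInjective_repFun : IsBaseInjective (repFun S.act) :=
  (galoisMap_injective_iff _).1 S.bijective.1

theorem act_injective {h h' : S.H} (hh : ∀ m, S.act h m = S.act h' m) : h = h' :=
  S.isBaseInjective_repFun.injective (funext hh)

theorem finite_and_finrank [FiniteDimensional K M] :
    FiniteDimensional K S.H ∧ Module.finrank K S.H = Module.finrank K M := by
  have hinj : Function.Injective S.act.toLinearMap := fun h h' hh =>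
    S.act_injective fun m => DFunLike.congr_fun hh m
  have hfin : FiniteDimensional K S.H := FiniteDimensional.of_injective _ hinj
  refine ⟨hfin, ?_⟩
  have := (LinearEquiv.ofBijective _ S.bijective).finrank_eq
  rw [Module.finrank_tensorProduct, Module.finrank_linearMap] at this
  exact Nat.eq_of_mul_eq_mul_left Module.finrank_pos this

instance [FiniteDimensional K M] : FiniteDimensional K S.H := S.finite_and_finrank.1

theorem finrank_eq [FiniteDimensional K M] : Module.finrank K S.H = Module.finrank K M :=
  S.finite_and_finrank.2

theorem mul'_map_flip_eq_tensorEval {H : Type*} [Ring H] [Algebra K H]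
    (ρ : H →ₐ[K] Module.End K M) (x y : M) (d : H ⊗[K] H) :
    LinearMap.mul' K M (TensorProduct.map (ρ.toLinearMap.flip x) (ρ.toLinearMap.flip y) d) =
      tensorEval (repFun ρ) (repFun ρ) d (x, y) := by
  induction d with
  | zero => simp
  | add a b ha hb => simp [ha, hb]
  | tmul a h => simp

theorem act_mul_eq_tensorEval (h : S.H) (x y : M) : S.act h (x * y) =
    tensorEval (repFun S.act) (repFun S.act) (Coalgebra.comul (R := K) h) (x, y) := by
  rw [S.act_mul, mul'_map_flip_eq_tensorEval]

/-- An algebra homomorphism into the Hopf algebra of a Hopf Galois structure through which a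
bialgebra acts by a Hopf action is a bialgebra homomorphism. -/
theorem exists_bialgHom {B : Type*} [Ring B] [Bialgebra K B] (e : B →ₐ[K] S.H)
    (h1 : ∀ b, S.act (e b) 1 = algebraMap K M (Coalgebra.counit b))
    (hmul : ∀ b x y, S.act (e b) (x * y) =
      tensorEval (repFun (S.act.comp e)) (repFun (S.act.comp e)) (Coalgebra.comul (R := K) b)
        (x, y)) : ∃ e' : B →ₐc[K] S.H, ∀ b, e' b = e b := by
  refine ⟨BialgHom.ofAlgHom e ?_ ?_, fun b => rfl⟩
  · ext b
    have := S.act_one (e b)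
    rw [h1] at this
    exact ((algebraMap K M).injective this).symm
  · ext b
    -- Elements of `H ⊗ H` are determined by their values on `M × M`, so the action on products
    -- determines the comultiplication.
    refine (S.isBaseInjective_repFun.tensorEval S.isBaseInjective_repFun).injective ?_
    ext ⟨x, y⟩
    refine Eq.trans ?_ (S.act_mul_eq_tensorEval (e b) x y)
    rw [hmul]
    simp only [AlgHom.comp_apply, Bialgebra.comulAlgHom_apply]
    generalize (Coalgebra.comul (R := K) b) = d
    induction d with
    | zero => simp
    | add a b ha hb => simp only [map_add, Pi.add_apply, ha, hb]
    | tmul a h => simp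

/-- The action is faithful and determines product, counit and comultiplication, so a structure is
known from the image of its Hopf algebra in `End_K(M)`. One inclusion suffices because both Hopf
algebras have dimension `[M : K]`. -/
theorem isIso_of_forall_exists [FiniteDimensional K M] (S T : HopfGaloisStructure K M)
    (hST : ∀ h : S.H, ∃ h' : T.H, ∀ m, T.act h' m = S.act h m) : S.IsIso T := by
  choose e he using hST
  let e' : S.H →ₐ[K] T.H :=
    { toFun := e
      map_one' := T.act_injective fun m => by simp [he]
      map_mul' := fun a b => T.act_injective fun m => by simp [he]
      map_zero' := T.act_injective fun m => by simp [he]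
      map_add' := fun a b => T.act_injective fun m => by simp [he]
      commutes' := fun c => T.act_injective fun m => by simp [he] }
  have hact : ∀ h, T.act (e' h) = S.act h := fun h => LinearMap.ext (he h)
  have hcomp : T.act.comp e' = S.act := AlgHom.ext hact
  obtain ⟨f, hf⟩ := T.exists_bialgHom e' (fun b => by rw [hact, S.act_one])
    (fun b x y => by rw [hact, hcomp, S.act_mul_eq_tensorEval])
  have hinj : Function.Injective f := fun a b hab => by
    refine S.act_injective fun m => ?_
    rw [← hact, ← hact, ← hf, ← hf, hab]
  have hbij : Function.Bijective f := by
    refine ⟨hinj, ?_⟩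
    exact (LinearMap.injective_iff_surjective_of_finrank_eq_finrank (f := (f : S.H →ₗ[K] T.H))
      (by rw [S.finrank_eq, T.finrank_eq])).1 hinj
  refine ⟨BialgEquiv.ofBijective f hbij, fun h x => ?_⟩
  rw [← hact, ← hf]
  rfl

end HopfGaloisStructure

/-! ### Evaluation of `L ⊗ H` at elements of the Galois group -/

namespace HopfGaloisStructure

section EvalAt

variable {K M L Γ : Type*} [Field K] [Field M] [Field L] [Algebra K M] [Algebra K L] [Algebra M L]
  [IsScalarTower K M L] [Group Γ] [MulSemiringAction Γ L] [hG : IsGaloisGroup Γ K L]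
  (S : HopfGaloisStructure K M)

/-- The map `L ⊗ H → (M → L)`, `l ⊗ h ↦ (m ↦ l γ(h · m))`. -/
def evalAt (γ : Γ) : L ⊗[K] S.H →ₗ[L] M → L :=
  LinearMap.liftBaseChange L
    { toFun := fun h m => γ • algebraMap M L (S.act h m)
      map_add' := fun h h' => by ext; simp
      map_smul' := fun c h => by
        ext m
        rw [map_smul, LinearMap.smul_apply, Algebra.smul_def, map_mul,
          ← IsScalarTower.algebraMap_apply K M L, smul_mul', smul_algebraMap_eq, Pi.smul_apply,
          Algebra.smul_def, RingHom.id_apply] }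

@[simp] theorem evalAt_tmul (γ : Γ) (l : L) (h : S.H) (m : M) :
    S.evalAt γ (l ⊗ₜ[K] h) m = l * γ • algebraMap M L (S.act h m) := by
  simp [evalAt]

theorem evalAt_one_apply (γ : Γ) (m : M) :
    S.evalAt γ (1 : L ⊗[K] S.H) m = γ • algebraMap M L m := by
  simp [Algebra.TensorProduct.one_def]

/-- The semilinear action of the Galois group on `L ⊗ H`. -/
def smulBase (γ : Γ) : L ⊗[K] S.H →+ L ⊗[K] S.H :=
  (LinearMap.rTensor S.H (MulSemiringAction.toAlgHom K L γ).toLinearMap).toAddMonoidHom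

@[simp] theorem smulBase_tmul (γ : Γ) (l : L) (h : S.H) :
    S.smulBase γ (l ⊗ₜ[K] h) = (γ • l) ⊗ₜ h := rfl

theorem smulBase_smul (γ : Γ) (l : L) (a : L ⊗[K] S.H) :
    S.smulBase γ (l • a) = (γ • l) • S.smulBase γ a := by
  induction a with
  | zero => simp
  | add a b ha hb => simp [ha, hb]
  | tmul c h => simp [TensorProduct.smul_tmul']

theorem evalAt_smulBase (γ δ : Γ) (a : L ⊗[K] S.H) (m : M) :
    S.evalAt (γ * δ) (S.smulBase γ a) m = γ • S.evalAt δ a m := by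
  induction a with
  | zero => simp
  | add a b ha hb => simp [ha, hb]
  | tmul c h => simp [mul_smul]

/-- An element that acts at `γ` as the embedding `δ` moves the point of evaluation from `γ` to `δ`.
This is how products in `L ⊗ H` become compositions of permutations of cosets. -/
theorem evalAt_mul {γ δ : Γ} {a : L ⊗[K] S.H}
    (h : ∀ m, S.evalAt γ a m = δ • algebraMap M L m) (b : L ⊗[K] S.H) (m : M) :
    S.evalAt γ (a * b) m = S.evalAt δ b m := by
  induction b with
  | zero => simp
  | add b c hb hc => simp [mul_add, hb, hc]
  | tmul l t =>
    rw [evalAt_tmul, ← h (S.act t m)]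
    clear h
    induction a with
    | zero => simp
    | add a b ha hb => simp [add_mul, ha, hb, mul_add]
    | tmul c h => simp only [Algebra.TensorProduct.tmul_mul_tmul, evalAt_tmul, map_mul,
        Module.End.mul_apply]; ring

theorem evalAt_apply_one (γ : Γ) (a : L ⊗[K] S.H) :
    S.evalAt γ a 1 = Coalgebra.counit (R := L) a := by
  induction a with
  | zero => simp
  | add a b ha hb => simp [ha, hb]
  | tmul c h =>
    rw [evalAt_tmul, S.act_one, ← IsScalarTower.algebraMap_apply K M L, smul_algebraMap_eq]
    simp [Algebra.smul_def, mul_comm]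

theorem evalAt_mul_apply (γ : Γ) (a : L ⊗[K] S.H) (x y : M) :
    S.evalAt γ a (x * y) =
      tensorEval (S.evalAt γ) (S.evalAt γ) (Coalgebra.comul (R := L) a) (x, y) := by
  induction a with
  | zero => simp
  | add a b ha hb => simp [ha, hb]
  | tmul c h =>
    rw [evalAt_tmul, S.act_mul_eq_tensorEval, TensorProduct.comul_tmul,
      CommSemiring.comul_apply]
    generalize (Coalgebra.comul (R := K) h) = d
    induction d with
    | zero => simp
    | add a b ha hb => simp only [map_add, Pi.add_apply, ha, hb, TensorProduct.tmul_add,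
        smul_add, mul_add]
    | tmul a h => simp; ring

theorem evalAt_one_injective : Function.Injective (S.evalAt (L := L) (1 : Γ)) :=
  by
  refine S.isBaseInjective_repFun.extend (Q' := L) (f' := _) fun v x => ?_
  simp

variable [FiniteDimensional K M]

theorem finrank_baseChange : Module.finrank L (L ⊗[K] S.H) = Module.finrank K M := by
  rw [Module.finrank_baseChange, S.finrank_eq]

/-- Evaluation at `1` is an injective `L`-linear map into `Hom_K(M, L)`, and both sides have
dimension `[M : K]`. -/
theorem exists_evalAt_one_eq (f : M →ₗ[K] L) : ∃ a, ∀ m, S.evalAt (1 : Γ) a m = f m := by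
  let F : L ⊗[K] S.H →ₗ[L] M →ₗ[K] L :=
    LinearMap.liftBaseChange L
      { toFun := fun h => (IsScalarTower.toAlgHom K M L).toLinearMap ∘ₗ S.act h
        map_add' := fun h h' => by ext; simp
        map_smul' := fun c h => by ext; simp [algebraMap.coe_smul] }
  have hF : ∀ a m, S.evalAt (1 : Γ) a m = F a m := fun a m => by
    induction a with
    | zero => simp
    | add a b ha hb => simp [ha, hb]
    | tmul c h => simp [F]
  have hinj : Function.Injective F := fun a b hab =>
    S.evalAt_one_injective (Γ := Γ) (funext fun m => by rw [hF, hF, hab])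
  have hsurj : Function.Surjective F := by
    refine (LinearMap.injective_iff_surjective_of_finrank_eq_finrank ?_).1 hinj
    rw [S.finrank_baseChange, Module.finrank_linearMap_self]
  obtain ⟨a, ha⟩ := hsurj f
  exact ⟨a, fun m => by rw [hF, ha]⟩

end EvalAt

end HopfGaloisStructure

/-! ### Coset systems and regular permutation groups -/

/-- `X` is a system of representatives of the left cosets of `Gal(L/M)` in the Galois group `Γ`
of `L/K`, on which `Γ` acts by left translation. -/
structure IsCosetSystem (K M L : Type*) {Γ X : Type*} [Field K] [Field M] [Field L] [Algebra K M]
    [Algebra M L] [Group Γ] [MulSemiringAction Γ L] [One X]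
    (lam : Γ →* Equiv.Perm X) (rep : X → Γ) : Prop where
  rep_lam : ∀ γ x (m : M), rep (lam γ x) • algebraMap M L m = γ • rep x • algebraMap M L m
  rep_one : ∀ m : M, rep 1 • algebraMap M L m = algebraMap M L m
  ext : ∀ x y, (∀ m : M, rep x • algebraMap M L m = rep y • algebraMap M L m) → x = y
  card : Nat.card X = Module.finrank K M
  fixed : ∀ l : L, (∀ γ, lam γ 1 = 1 → γ • l = l) → l ∈ Set.range (algebraMap M L)

section CosetSystem

variable {K M L Γ X : Type*} [Field K] [Field M] [Field L] [Algebra K M] [Algebra K L] [Algebra M L]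
  [IsScalarTower K M L] [Group Γ] [MulSemiringAction Γ L] [hG : IsGaloisGroup Γ K L] [One X]
  {lam : Γ →* Equiv.Perm X} {rep : X → Γ}

variable (K M) in
/-- The embedding of `M` into `L` given by an element of the Galois group. -/
def embedding (γ : Γ) : M →ₐ[K] L :=
  (MulSemiringAction.toAlgHom K L γ).comp (IsScalarTower.toAlgHom K M L)

namespace IsCosetSystem

variable (hX : IsCosetSystem K M L lam rep)
include hX

theorem embedding_injective : Function.Injective (fun x => embedding (L := L) K M (rep x)) :=
  fun x y h => hX.ext x y fun m => DFunLike.congr_fun h m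

theorem linearIndependent :
    LinearIndependent L (fun x (m : M) => rep x • algebraMap M L m) := by
  have := (linearIndependent_toLinearMap K M L).comp _ hX.embedding_injective
  exact this.map' { toFun := fun f m => f m, map_add' := fun _ _ => rfl, map_smul' := fun _ _ => rfl }
    (LinearMap.ker_eq_bot.2 DFunLike.coe_injective)

theorem lam_rep (x : X) : lam (rep x) 1 = x :=
  hX.ext _ _ fun m => by rw [hX.rep_lam, hX.rep_one]

variable [FiniteDimensional K M]

theorem finite : Finite X := by
  refine Nat.finite_of_card_ne_zero ?_
  rw [hX.card]
  exact Module.finrank_pos.ne'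

/-- Distinct points give distinct embeddings, and by Dedekind there are at most `[M : K] = |X|`
embeddings. -/
theorem exists_rep (f : M →ₐ[K] L) : ∃ x, ∀ m, f m = rep x • algebraMap M L m := by
  have := hX.finite
  have := Fintype.ofFinite X
  have hbij := (Fintype.bijective_iff_injective_and_card
    (fun x => embedding (L := L) K M (rep x))).2 ⟨hX.embedding_injective, by
      refine le_antisymm (Fintype.card_le_of_injective _ hX.embedding_injective) ?_
      rw [← Nat.card_eq_fintype_card (α := X), hX.card, ← Module.finrank_linearMap_self K L M]
      exact (linearIndependent_toLinearMap K M L).fintype_card_le_finrank⟩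
  obtain ⟨x, rfl⟩ := hbij.2 f
  exact ⟨x, fun m => rfl⟩

end IsCosetSystem

end CosetSystem

theorem IsRegularPermGroup.eq_of_apply_eq {X : Type*} {N : Subgroup (Equiv.Perm X)}
    (hN : IsRegularPermGroup N) {n n' : N} {x : X}
    (h : (n : Equiv.Perm X) x = (n' : Equiv.Perm X) x) : n = n' :=
  (hN x _).unique h rfl

theorem IsRegularPermGroup.exists_inv_apply_eq {X : Type*} {N : Subgroup (Equiv.Perm X)}
    (hN : IsRegularPermGroup N) (x y : X) : ∃ n : N, (n : Equiv.Perm X)⁻¹ x = y := by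
  obtain ⟨n, hn, -⟩ := hN x y
  exact ⟨n⁻¹, by simpa using hn⟩

theorem IsRegularPermGroup.inv_apply_injective {X : Type*} {N : Subgroup (Equiv.Perm X)}
    (hN : IsRegularPermGroup N) (x : X) :
    Function.Injective (fun n : N => (n : Equiv.Perm X)⁻¹ x) := by
  intro n n' h
  have h' : ((n⁻¹ : N) : Equiv.Perm X) x = ((n'⁻¹ : N) : Equiv.Perm X) x := by simpa using h
  exact inv_injective (hN.eq_of_apply_eq h')

theorem IsRegularPermGroup.card {X : Type*} [One X] {N : Subgroup (Equiv.Perm X)}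
    (hN : IsRegularPermGroup N) : Nat.card N = Nat.card X :=
  Nat.card_congr (Equiv.ofBijective _
    ⟨hN.inv_apply_injective 1, fun y => hN.exists_inv_apply_eq 1 y⟩)

section Conj

variable {Γ X : Type*} [Group Γ] {lam : Γ →* Equiv.Perm X} {N : Subgroup (Equiv.Perm X)}

/-- The conjugation action on a group of permutations normalized by the image of `lam`. -/
def conjHom (h : lam.range ≤ Subgroup.normalizer (N : Set (Equiv.Perm X))) : Γ →* MulAut N :=
  N.normalizerMonoidHom.comp (lam.codRestrict _ fun γ => h ⟨γ, rfl⟩)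

@[simp] theorem coe_conjHom (h : lam.range ≤ Subgroup.normalizer (N : Set (Equiv.Perm X))) (γ : Γ)
    (n : N) : ((conjHom h γ n : N) : Equiv.Perm X) = lam γ * n * (lam γ)⁻¹ := rfl

theorem mem_fixedGroupAlgebra_iff {L : Type*} [Field L] [MulSemiringAction Γ L]
    (h : lam.range ≤ Subgroup.normalizer (N : Set (Equiv.Perm X))) (a : MonoidAlgebra L N) :
    a ∈ fixedGroupAlgebra L lam N ↔ ∀ γ n, a.coeff (conjHom h γ n) = γ • a.coeff n :=
  ⟨fun ha γ n => ha γ n _ rfl, fun ha γ n n' hn => by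
    rw [show n' = conjHom h γ n from Subtype.ext hn, ha]⟩

end Conj

/-! ### Greither–Pareigis: from Hopf Galois structures to permutation groups -/

namespace HopfGaloisStructure

variable {K M L Γ X : Type*} [Field K] [Field M] [Field L] [Algebra K M] [Algebra K L] [Algebra M L]
  [IsScalarTower K M L] [Group Γ] [MulSemiringAction Γ L] [hG : IsGaloisGroup Γ K L]
  (S : HopfGaloisStructure K M)

theorem evalAt_congr {γ δ : Γ} (h : ∀ m : M, γ • algebraMap M L m = δ • algebraMap M L m)
    (a : L ⊗[K] S.H) : S.evalAt γ a = S.evalAt δ a := by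
  ext m
  induction a with
  | zero => simp
  | add a b ha hb => simp [ha, hb]
  | tmul c t => simp [h]

theorem evalAt_add (γ : Γ) (a : L ⊗[K] S.H) (x y : M) :
    S.evalAt γ a (x + y) = S.evalAt γ a x + S.evalAt γ a y := by
  induction a with
  | zero => simp
  | add a b ha hb => simp only [map_add, Pi.add_apply, ha, hb]; ring
  | tmul c t => simp [mul_add]

theorem evalAt_smul (γ : Γ) (a : L ⊗[K] S.H) (k : K) (x : M) :
    S.evalAt γ a (k • x) = k • S.evalAt γ a x := by
  induction a with
  | zero => simp
  | add a b ha hb => simp only [map_add, Pi.add_apply, ha, hb, smul_add]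
  | tmul c t =>
    have h : algebraMap M L (S.act t (k • x)) =
        algebraMap K L k * algebraMap M L (S.act t x) := by
      rw [map_smul, Algebra.smul_def, map_mul, ← IsScalarTower.algebraMap_apply K M L]
    rw [evalAt_tmul, evalAt_tmul, h, smul_mul', smul_algebraMap_eq, ← mul_assoc, mul_comm c,
      mul_assoc, Algebra.smul_def]

/-- The values of `evalAt` are linear maps. -/
def evalAtLinear (γ : Γ) (a : L ⊗[K] S.H) : M →ₗ[K] L where
  toFun := S.evalAt γ a
  map_add' := S.evalAt_add γ a
  map_smul' := S.evalAt_smul γ a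

/-- In a basis of vectors `1 ⊗ b i`, the coordinates of a fixed element are fixed, hence in `K`. -/
theorem exists_eq_one_tmul_of_smulBase_eq (a : L ⊗[K] S.H) (ha : ∀ γ : Γ, S.smulBase γ a = a) :
    ∃ h : S.H, a = 1 ⊗ₜ h := by
  let b := Module.Basis.ofVectorSpace K S.H
  obtain ⟨B, hB⟩ : ∃ B : Module.Basis _ L (L ⊗[K] S.H), ∀ i, B i = 1 ⊗ₜ b i :=
    ⟨b.baseChange L, fun i => by simp⟩
  have hsum : ((B.repr a).sum fun i l => l • B i) = a := by
    rw [← Finsupp.linearCombination_apply, B.linearCombination_repr]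
  have hc := mem_range_algebraMap_of_fixed (K := K) (T := fun γ : Γ => S.smulBase γ)
    (fun γ l w => S.smulBase_smul γ l w) B.linearIndependent (fun γ i => by simp [hB])
    (B.repr a) (fun γ => by rw [hsum, ha])
  choose k hk using hc
  refine ⟨(B.repr a).sum fun i l => k i • b i, ?_⟩
  rw [Finsupp.sum, TensorProduct.tmul_sum]
  refine hsum.symm.trans ?_
  refine Finset.sum_congr rfl fun i _ => ?_
  change (B.repr a) i • B i = _
  rw [hB, ← hk, TensorProduct.tmul_smul, TensorProduct.smul_tmul', TensorProduct.smul_tmul',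
    Algebra.smul_def (k i), smul_eq_mul]

/-- The map `δ` is multiplicative, so `comul a` and `a ⊗ a` have the same values on `M × M`; these
values determine them. -/
theorem isGroupLikeElem_of_evalAt {a : L ⊗[K] S.H} {δ : Γ}
    (h : ∀ m, S.evalAt (1 : Γ) a m = δ • algebraMap M L m) : IsGroupLikeElem L a := by
  refine ⟨by rw [← S.evalAt_apply_one (1 : Γ), h, map_one, smul_one], ?_⟩
  have hinj := isBaseInjective_of_injective (S.evalAt_one_injective (L := L) (Γ := Γ))
  refine (hinj.tensorEval hinj).injective ?_
  ext ⟨x, y⟩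
  rw [← evalAt_mul_apply, tensorEval_tmul, h, h, h, map_mul, smul_mul']

/-- The element `a` of `L ⊗ H` represents the permutation `n` of the coset space: it acts on
`L ⊗ M = Map(X, L)` through the permutation `n` of `X`. -/
def Represents (rep : X → Γ) (n : Equiv.Perm X) (a : L ⊗[K] S.H) : Prop :=
  ∀ x m, S.evalAt (rep x) a m = rep (n⁻¹ x) • algebraMap M L m

variable {S} {rep : X → Γ}

theorem Represents.mul {n n' : Equiv.Perm X} {a b : L ⊗[K] S.H} (ha : S.Represents rep n a)
    (hb : S.Represents rep n' b) : S.Represents rep (n * n') (a * b) := fun x m => by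
  rw [S.evalAt_mul (ha x), hb, mul_inv_rev, Equiv.Perm.mul_apply]

theorem represents_one : S.Represents (L := L) rep 1 1 := fun x m => by
  rw [evalAt_one_apply]; simp

variable [One X] {lam : Γ →* Equiv.Perm X} (hX : IsCosetSystem K M L lam rep)
include hX

theorem Represents.evalAt_one {n : Equiv.Perm X} {a : L ⊗[K] S.H} (ha : S.Represents rep n a)
    (m : M) : S.evalAt (1 : Γ) a m = rep (n⁻¹ 1) • algebraMap M L m := by
  rw [← ha, S.evalAt_congr (γ := rep 1) (δ := (1 : Γ)) fun m => by rw [hX.rep_one, one_smul]]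

theorem Represents.unique {n : Equiv.Perm X} {a b : L ⊗[K] S.H} (ha : S.Represents rep n a)
    (hb : S.Represents rep n b) : a = b :=
  S.evalAt_one_injective (L := L) (Γ := Γ) <| funext fun m => by
    rw [ha.evalAt_one hX, hb.evalAt_one hX]

theorem Represents.isGroupLikeElem {n : Equiv.Perm X} {a : L ⊗[K] S.H}
    (ha : S.Represents rep n a) : IsGroupLikeElem L a :=
  S.isGroupLikeElem_of_evalAt (ha.evalAt_one hX)

theorem Represents.smulBase {n : Equiv.Perm X} {a : L ⊗[K] S.H}
    (ha : S.Represents rep n a) (γ : Γ) :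
    S.Represents rep (lam γ * n * (lam γ)⁻¹) (S.smulBase γ a) := fun x m => by
  have h1 : ∀ m : M, rep x • algebraMap M L m = (γ * rep ((lam γ)⁻¹ x)) • algebraMap M L m := by
    intro m
    rw [mul_smul, ← hX.rep_lam]
    simp
  rw [S.evalAt_congr h1, evalAt_smulBase, ha, ← hX.rep_lam]
  simp [mul_assoc]

variable [FiniteDimensional K M]

/-- By uniqueness the representatives multiply as `N` does, which gives an algebra map `L[N] → L ⊗
H`. It is a bialgebra map because representatives are group-like, and bijective by independence of
embeddings and a dimension count. Galois twisting of a representative is conjugation in `N`, so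
fixed elements match fixed elements. -/
theorem correspondsTo_of_represents {N : Subgroup (Equiv.Perm X)} (hN : IsRegularPermGroup N)
    (hnorm : lam.range ≤ Subgroup.normalizer (N : Set (Equiv.Perm X)))
    (hrep : ∀ n : N, ∃ a : L ⊗[K] S.H, S.Represents rep n a) :
    S.CorrespondsTo (L := L) lam rep N := by
  have := hX.finite
  have := Fintype.ofFinite N
  choose a ha using hrep
  let f : N →* L ⊗[K] S.H :=
    { toFun := a
      map_one' := (ha 1).unique hX represents_one
      map_mul' := fun n n' => (ha _).unique hX ((ha n).mul (ha n')) }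
  let P := MonoidAlgebra.lift L (L ⊗[K] S.H) N f
  have hP : ∀ x, P x = ∑ n, x.coeff n • a n := fun x => by
    simp only [P, MonoidAlgebra.lift_apply]
    exact Finsupp.sum_fintype _ _ (by simp)
  have hPsingle : ∀ n, P (MonoidAlgebra.single n 1) = a n := fun n => by
    simp [P, f]
  have heval : ∀ x m, S.evalAt (1 : Γ) (P x) m =
      ∑ n, x.coeff n * rep ((n : Equiv.Perm X)⁻¹ 1) • algebraMap M L m := fun x m => by
    rw [hP]
    simp [(ha _).evalAt_one hX]
  -- Evaluated at `1`, the representatives are the embeddings attached to the points `n⁻¹ 1`, which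
  -- are distinct by regularity.
  have hli : LinearIndependent L (fun n => a n) := by
    have := hX.linearIndependent.comp _ (hN.inv_apply_injective 1)
    refine LinearIndependent.of_comp (S.evalAt (1 : Γ)) ?_
    convert! this using 1
    ext n m
    simp [(ha _).evalAt_one hX]
  have hPinj : Function.Injective P := by
    rw [injective_iff_map_eq_zero]
    intro x hx
    rw [hP] at hx
    ext n
    simpa using Fintype.linearIndependent_iff.1 hli _ hx n
  have hPbij : Function.Bijective P := by
    refine ⟨hPinj, (LinearMap.injective_iff_surjective_of_finrank_eq_finrank
      (f := P.toLinearMap) ?_).1 hPinj⟩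
    rw [Module.finrank_eq_nat_card_basis (MonoidAlgebra.basis N L), S.finrank_baseChange,
      hN.card, hX.card]
  let Pb : MonoidAlgebra L N →ₐc[L] L ⊗[K] S.H := BialgHom.ofAlgHom P
    (by
      ext n
      simpa [hPsingle] using ((ha n).isGroupLikeElem hX).counit_eq_one)
    (by
      ext n
      simp [hPsingle, ((ha n).isGroupLikeElem hX).comul_eq_tmul_self])
  let e := BialgEquiv.ofBijective Pb hPbij
  have he : ∀ x, e x = P x := fun x => rfl
  refine ⟨hN, hnorm, e.symm, ?_, ?_⟩
  · ext x
    rw [mem_fixedGroupAlgebra_iff hnorm]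
    have hsm : ∀ γ : Γ, S.smulBase γ (P x) =
        ∑ n, (γ • x.coeff ((conjHom hnorm γ)⁻¹ n)) • a n := by
      intro γ
      rw [hP, map_sum]
      refine Fintype.sum_equiv (conjHom hnorm γ).toEquiv _ _ fun n => ?_
      rw [smulBase_smul, ((ha n).smulBase hX γ).unique hX (ha (conjHom hnorm γ n))]
      congr 3
      exact ((conjHom hnorm γ).symm_apply_apply n).symm
    -- With this, membership in `L[N]^Γ` is Galois invariance in `L ⊗ H`, and by descent the
    -- invariants are the elements `1 ⊗ t`.
    have hfix : (∀ (γ : Γ) n, x.coeff (conjHom hnorm γ n) = γ • x.coeff n) ↔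
        ∀ γ : Γ, S.smulBase γ (P x) = P x := by
      refine forall_congr' fun γ => ?_
      rw [hsm γ, hP, ← sub_eq_zero (a := ∑ n, _), ← Finset.sum_sub_distrib]
      simp_rw [← sub_smul]
      constructor
      · intro h
        refine Finset.sum_eq_zero fun n _ => ?_
        rw [← h]
        simp
      · intro h n
        have := Fintype.linearIndependent_iff.1 hli _ h (conjHom hnorm γ n)
        rw [sub_eq_zero] at this
        rw [← this]
        congr 2
        exact (conjHom hnorm γ).symm_apply_apply n
    rw [hfix]
    constructor
    · rintro ⟨h, rfl⟩ γ
      rw [← he, BialgEquiv.apply_symm_apply]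
      simp
    · intro h
      obtain ⟨t, ht⟩ := S.exists_eq_one_tmul_of_smulBase_eq _ h
      refine ⟨t, ?_⟩
      change e.symm (1 ⊗ₜ[K] t) = x
      rw [← ht, ← he]
      exact e.symm_apply_apply x
  · intro h m
    have h1 := heval (e.symm (1 ⊗ₜ h)) m
    rw [← he, BialgEquiv.apply_symm_apply] at h1
    rw [Finsupp.sum_fintype _ _ (by simp)]
    refine Eq.trans ?_ h1
    rw [evalAt_tmul, one_smul, one_mul]

/-- A group-like element evaluates to a unital multiplicative map, that is, to a `K`-embedding of
`M` into `L`. -/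
theorem exists_represents_of_isGroupLikeElem {a : L ⊗[K] S.H} (ha : IsGroupLikeElem L a) (γ : Γ) :
    ∃ x, ∀ m, S.evalAt γ a m = rep x • algebraMap M L m :=
  hX.exists_rep (AlgHom.ofLinearMap (S.evalAtLinear γ a)
    ((S.evalAt_apply_one γ a).trans ha.counit_eq_one)
    (fun x y => (S.evalAt_mul_apply γ a x y).trans (by rw [ha.comul_eq_tmul_self]; rfl)))

variable (S) in
/-- One half of the Greither-Pareigis correspondence: every Hopf Galois structure comes from a
regular group of permutations. -/
theorem exists_correspondsTo : ∃ N, S.CorrespondsTo (L := L) lam rep N := by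
  have hex : ∀ (a : GroupLike L (L ⊗[K] S.H)) (x : X), ∃ y, ∀ m,
      S.evalAt (rep x) a.val m = rep y • algebraMap M L m :=
    fun a x => exists_represents_of_isGroupLikeElem hX a.2 _
  choose act hact using hex
  have act_one : ∀ x, act 1 x = x := fun x => hX.ext _ _ fun m => by
    rw [← hact, GroupLike.val_one, evalAt_one_apply]
  have act_mul : ∀ a b x, act (a * b) x = act b (act a x) := fun a b x => hX.ext _ _ fun m => by
    rw [← hact, ← hact, GroupLike.val_mul, S.evalAt_mul (hact a x)]
  -- The group-like elements act on `X` from the right; the inverse turns this into a left action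
  -- and agrees with the `n⁻¹` in the action formula.
  let f : GroupLike L (L ⊗[K] S.H) →* Equiv.Perm X :=
    { toFun := fun a =>
        { toFun := act a⁻¹
          invFun := act a
          left_inv := fun x => by rw [← act_mul, inv_mul_cancel, act_one]
          right_inv := fun x => by rw [← act_mul, mul_inv_cancel, act_one] }
      map_one' := Equiv.ext fun x => by simp [act_one]
      map_mul' := fun a b => Equiv.ext fun x => by simp [act_mul] }
  have hf : ∀ a, S.Represents rep (f a) a.val := fun a x m => hact a x m
  -- Any permutation that is represented lies in the group. As Galois twists of representatives
  -- represent the conjugates, this yields normalization below.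
  have hf' : ∀ a : L ⊗[K] S.H, ∀ n : Equiv.Perm X, S.Represents rep n a → n ∈ f.range := by
    intro a n hn
    refine ⟨⟨a, hn.isGroupLikeElem hX⟩, ?_⟩
    rw [← inv_inj]
    refine Equiv.ext fun x => hX.ext _ _ fun m => ?_
    rw [← hn, ← hf]
  -- The embedding attached to `y` is a `K`-linear map, so it is the evaluation of some element,
  -- which is group-like because the embedding is multiplicative.
  have htrans : ∀ y, ∃ a, act a 1 = y := fun y => by
    obtain ⟨a, ha⟩ := S.exists_evalAt_one_eq (L := L) (Γ := Γ) (embedding (L := L) K M (rep y)).toLinearMap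
    refine ⟨⟨a, S.isGroupLikeElem_of_evalAt ha⟩, hX.ext _ _ fun m => ?_⟩
    rw [← hact, S.evalAt_congr (γ := rep 1) (δ := (1 : Γ)) fun m => by rw [hX.rep_one, one_smul], ha]
    rfl
  have hfree : ∀ a b, act a 1 = act b 1 → a = b := fun a b hab => by
    refine GroupLike.val_injective (S.evalAt_one_injective (L := L) (Γ := Γ) (funext fun m => ?_))
    have := (hf a).evalAt_one hX m
    rw [(hf b).evalAt_one hX m]
    rw [this]
    congr 2
  refine ⟨f.range, correspondsTo_of_represents hX ?_ ?_ ?_⟩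
  · intro x y
    obtain ⟨a, rfl⟩ := htrans x
    obtain ⟨b, rfl⟩ := htrans y
    refine ⟨⟨f (b⁻¹ * a), _, rfl⟩, ?_, ?_⟩
    · change act (b⁻¹ * a)⁻¹ (act a 1) = act b 1
      rw [← act_mul]
      simp
    · rintro ⟨_, c, rfl⟩ hc
      refine Subtype.ext (congrArg f ?_)
      change act c⁻¹ (act a 1) = act b 1 at hc
      rw [← act_mul] at hc
      have := hfree _ _ hc
      rw [← this]
      simp
  · rintro _ ⟨γ, rfl⟩
    rw [Subgroup.mem_normalizer_iff]
    intro n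
    constructor
    · rintro ⟨a, rfl⟩
      exact hf' _ _ ((hf a).smulBase hX γ)
    · rintro ⟨a, ha⟩
      have := (hf a).smulBase hX γ⁻¹
      rw [ha] at this
      refine hf' (S.smulBase γ⁻¹ a.val) _ ?_
      convert! this using 1
      simp [mul_assoc]
  · rintro ⟨_, a, rfl⟩
    exact ⟨a.val, hf a⟩

/-- If `S` corresponds to `N`, then the elements of `N` are represented by elements of `L ⊗ H`. -/
theorem CorrespondsTo.exists_represents {N : Subgroup (Equiv.Perm X)}
    (hS : S.CorrespondsTo (L := L) lam rep N) :
    ∃ Φ : (L ⊗[K] S.H) ≃ₐc[L] MonoidAlgebra L N,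
      Set.range (fun h : S.H => Φ (1 ⊗ₜ[K] h)) = fixedGroupAlgebra L lam N ∧
      (∀ (h : S.H) (x : M), algebraMap M L (S.act h x) = (Φ (1 ⊗ₜ[K] h)).coeff.sum fun n c =>
        c * (rep ((n : Equiv.Perm X)⁻¹ 1) • algebraMap M L x)) ∧
      ∀ n : N, S.Represents rep n (Φ.symm (MonoidAlgebra.single n 1)) := by
  have := hX.finite
  have := Fintype.ofFinite N
  obtain ⟨Φ, hΦ, hact⟩ := hS.exists_equiv
  refine ⟨Φ, hΦ, hact, ?_⟩
  have heval : ∀ a m, S.evalAt (1 : Γ) a m =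
      ∑ n, (Φ a).coeff n * rep ((n : Equiv.Perm X)⁻¹ 1) • algebraMap M L m := fun a m => by
    induction a with
    | zero => simp
    | add a b ha hb => simp [ha, hb, add_mul, Finset.sum_add_distrib]
    | tmul c h =>
      have h1 : c ⊗ₜ[K] h = c • ((1 : L) ⊗ₜ[K] h) := by simp [TensorProduct.smul_tmul']
      have h2 := hact h m
      rw [Finsupp.sum_fintype _ _ (by simp)] at h2
      rw [evalAt_tmul, one_smul, h2, h1, map_smul]
      simp [Finset.mul_sum, mul_assoc]
  have hone : ∀ (n : N) m, S.evalAt (1 : Γ) (Φ.symm (MonoidAlgebra.single n 1)) m =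
      rep ((n : Equiv.Perm X)⁻¹ 1) • algebraMap M L m := fun n m => by
    classical
    rw [heval, BialgEquiv.apply_symm_apply]
    simp [Finsupp.single_apply]
  intro n x m
  -- The action formula only describes the base point `1`. Any other point is `n'⁻¹ 1`, and left
  -- multiplication by the element of `n'` carries the evaluation there.
  obtain ⟨n', rfl⟩ := hS.regular.exists_inv_apply_eq 1 x
  have := S.evalAt_mul (hone n') (Φ.symm (MonoidAlgebra.single n 1)) m
  rw [← this, ← map_mul, MonoidAlgebra.single_mul_single, mul_one, hone]
  simp

/-- Both Hopf algebras are identified with the same set `L[N]^Γ`, acting on `M` by the same formula.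
-/
theorem CorrespondsTo.isIso {T : HopfGaloisStructure K M} {N : Subgroup (Equiv.Perm X)}
    (hS : S.CorrespondsTo (L := L) lam rep N) (hT : T.CorrespondsTo (L := L) lam rep N) :
    S.IsIso T := by
  obtain ⟨Φ, hΦ, hact⟩ := hS.exists_equiv
  obtain ⟨Φ', hΦ', hact'⟩ := hT.exists_equiv
  refine isIso_of_forall_exists S T fun h => ?_
  obtain ⟨h', hh'⟩ : Φ (1 ⊗ₜ h) ∈ Set.range (fun h : T.H => Φ' (1 ⊗ₜ[K] h)) := by
    rw [hΦ', ← hΦ]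
    exact ⟨h, rfl⟩
  refine ⟨h', fun m => (algebraMap M L).injective ?_⟩
  rw [hact, hact', ← hh']

end HopfGaloisStructure

/-! ### The Hopf algebra structure on `L[N]^Γ` -/

/-- `A` is a form over `K` of the group algebra `L[N]`: it is identified by `cf` with the functions
`N → L` that are equivariant for the Galois group `Γ`, with the convolution product. -/
structure IsFixedGroupAlgebra {K L Γ N A : Type*} [Field K] [Field L] [Algebra K L] [Group Γ]
    [MulSemiringAction Γ L] [Group N] [Fintype N] [DecidableEq N] [Ring A] [Algebra K A]
    (c : Γ →* MulAut N) (cf : A →ₗ[K] N → L) : Prop where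
  map_one : ∀ n, cf 1 n = if n = 1 then 1 else 0
  map_mul : ∀ a b n, cf (a * b) n = ∑ m, cf a m * cf b (m⁻¹ * n)
  injective : Function.Injective cf
  mem_range : ∀ f, f ∈ Set.range cf ↔ ∀ γ n, f (c γ n) = γ • f n

section

variable {K L Γ : Type*} [Field K] [Field L] [Algebra K L] [Group Γ] [Finite Γ]
  [MulSemiringAction Γ L] [hG : IsGaloisGroup Γ K L]

/-- The semilinear action on functions on a set with an action. -/
def funAction {Y : Type*} (L : Type*) [Field L] [MulSemiringAction Γ L] (c : Γ →* Equiv.Perm Y)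
    (γ : Γ) : (Y → L) →+ (Y → L) where
  toFun f y := γ • f (c γ⁻¹ y)
  map_zero' := by ext; simp
  map_add' f g := by ext; simp

theorem funAction_eq_iff {Y : Type*} (c : Γ →* Equiv.Perm Y) (f : Y → L) :
    (∀ γ, funAction L c γ f = f) ↔ ∀ γ y, f (c γ y) = γ • f y := by
  refine forall_congr' fun γ => ?_
  rw [funext_iff]
  constructor
  · intro h y
    rw [← h]
    simp [funAction]
  · intro h y
    have := h (c γ⁻¹ y)
    simp only [funAction, AddMonoidHom.coe_mk, ZeroHom.coe_mk]
    rw [← this]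
    simp

theorem funAction_smul {Y : Type*} (c : Γ →* Equiv.Perm Y) (γ : Γ) (l : L) (f : Y → L) :
    funAction L c γ (l • f) = (γ • l) • funAction L c γ f := by
  ext y; simp [funAction]

variable {V Y : Type*} [AddCommGroup V] [Module K V] [Fintype Y]

include hG in
/-- A base-injective family of invariant functions of the right dimension consists of all the
invariant functions. -/
theorem IsBaseInjective.exists_eq_of_fixed {f : V →ₗ[K] Y → L} (hf : IsBaseInjective f)
    (hV : Module.finrank K V = Fintype.card Y) (c : Γ →* Equiv.Perm Y)
    (hfix : ∀ v γ y, f v (c γ y) = γ • f v y) (g : Y → L) (hg : ∀ γ y, g (c γ y) = γ • g y) :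
    ∃ v, f v = g := by
  have := hf.finrank_le.1
  let b := Module.finBasis K V
  have hli := (isBaseInjective_iff_linearIndependent b).1 hf
  rcases isEmpty_or_nonempty Y with hY | hY
  · exact ⟨0, Subsingleton.elim _ _⟩
  have : Nonempty (Fin (Module.finrank K V)) := by
    rw [hV]; exact Fin.pos_iff_nonempty.1 Fintype.card_pos
  -- By the dimension hypothesis the functions form an `L`-basis of all functions on `Y`, and an
  -- equivariant function has coordinates in `K`.
  let B := basisOfLinearIndependentOfCardEqFinrank hli (by simp [hV])
  have hB : ∀ i, B i = f (b i) := fun i => by simp [B]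
  have hsum : ((B.repr g).sum fun i l => l • f (b i)) = g := by
    simp_rw [← hB]
    rw [← Finsupp.linearCombination_apply, B.linearCombination_repr]
  have hc := mem_range_algebraMap_of_fixed (K := K) (T := fun γ : Γ => funAction L c γ)
    (funAction_smul c) hli (fun γ i => (funAction_eq_iff c _).2 (hfix (b i)) γ)
    (B.repr g) (fun γ => by rw [hsum]; exact (funAction_eq_iff c g).2 hg γ)
  choose k hk using hc
  refine ⟨(B.repr g).sum fun i l => k i • b i, ?_⟩
  refine Eq.trans ?_ hsum
  rw [Finsupp.sum, map_sum]
  refine Finset.sum_congr rfl fun i _ => ?_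
  change _ = (B.repr g) i • f (b i)
  rw [← hk, map_smul, algebraMap_smul]

end

namespace IsFixedGroupAlgebra

variable {K L Γ N A : Type*} [Field K] [Field L] [Algebra K L] [Group Γ] [Finite Γ]
  [MulSemiringAction Γ L] [hG : IsGaloisGroup Γ K L] [Group N] [Fintype N] [DecidableEq N]
  [Ring A] [Algebra K A] {c : Γ →* MulAut N} {cf : A →ₗ[K] N → L}
  (h : IsFixedGroupAlgebra c cf)
include h

theorem map_conj (a : A) (γ : Γ) (n : N) : cf a (c γ n) = γ • cf a n :=
  (h.mem_range _).1 ⟨a, rfl⟩ γ n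

theorem isBaseInjective : IsBaseInjective cf := by
  let b := Module.Basis.ofVectorSpace K A
  rw [isBaseInjective_iff_linearIndependent b]
  refine linearIndependent_of_fixed (K := K)
    (T := fun γ : Γ => funAction L ((MulAut.toPerm N).comp c) γ) (funAction_smul _)
    (fun γ i => (funAction_eq_iff _ _).2 (h.map_conj (b i)) γ) ?_
  exact b.linearIndependent.map' cf (LinearMap.ker_eq_bot.2 h.injective)

theorem finite_and_finrank : Module.Finite K A ∧ Module.finrank K A = Fintype.card N := by
  obtain ⟨hfin, hle⟩ := h.isBaseInjective.finrank_le
  rw [Nat.card_eq_fintype_card] at hle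
  refine ⟨hfin, le_antisymm hle ?_⟩
  let b := Module.finBasis K A
  -- Independence over `L` bounds the dimension above by `|N|`; that the equivariant functions span
  -- bounds it below.
  have hspan := span_fixed_eq_top (K := K)
    (T := fun γ : Γ => funAction L ((MulAut.toPerm N).comp c) γ) (funAction_smul _)
    (fun w => by ext; simp [funAction]) (fun γ δ w => by ext; simp [funAction, mul_smul])
  have htop : Submodule.span L (Set.range fun i => cf (b i)) = ⊤ := by
    rw [eq_top_iff, ← hspan, Submodule.span_le]
    intro w hw
    obtain ⟨a, rfl⟩ := (h.mem_range w).2 ((funAction_eq_iff _ _).1 hw)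
    rw [← b.sum_repr a, map_sum]
    refine Submodule.sum_mem _ fun i _ => ?_
    rw [map_smul, ← algebraMap_smul L]
    exact Submodule.smul_mem _ _ (Submodule.subset_span ⟨i, rfl⟩)
  have := finrank_range_le_card (R := L) (fun i => cf (b i))
  rw [Set.finrank, htop, finrank_top] at this
  simpa using this

theorem tensor_injective : Function.Injective (tensorEval cf cf) :=
  (h.isBaseInjective.tensorEval h.isBaseInjective).injective

theorem tensorEval_conj (d : A ⊗[K] A) (γ : Γ) (n n' : N) :
    tensorEval cf cf d (c γ n, c γ n') = γ • tensorEval cf cf d (n, n') := by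
  induction d with
  | zero => simp
  | add a b ha hb => simp only [map_add, Pi.add_apply, ha, hb, smul_add]
  | tmul a b => simp [h.map_conj]

theorem tensorEval_mul (d d' : A ⊗[K] A) (n n' : N) :
    tensorEval cf cf (d * d') (n, n') =
      ∑ m, ∑ m', tensorEval cf cf d (m, m') * tensorEval cf cf d' (m⁻¹ * n, m'⁻¹ * n') := by
  induction d with
  | zero => simp
  | add a b ha hb =>
    simp only [add_mul, map_add, Pi.add_apply, ha, hb, Finset.sum_add_distrib]
  | tmul a b =>
    induction d' with
    | zero => simp
    | add a b ha hb =>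
      simp only [mul_add, map_add, Pi.add_apply, ha, hb, Finset.sum_add_distrib]
    | tmul a' b' =>
      simp only [Algebra.TensorProduct.tmul_mul_tmul, tensorEval_tmul, h.map_mul,
        Finset.sum_mul_sum]
      exact Finset.sum_congr rfl fun m _ => Finset.sum_congr rfl fun m' _ => by ring

/-- The function supported on the diagonal with values `cf a` is equivariant on `N × N`, and `A ⊗
A`, of dimension `|N|²`, contains all equivariant functions. -/
theorem exists_comul (a : A) : ∃ d : A ⊗[K] A, ∀ n n',
    tensorEval cf cf d (n, n') = if n = n' then cf a n else 0 := by
  have := h.finite_and_finrank.1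
  let c' : Γ →* Equiv.Perm (N × N) :=
    { toFun := fun γ => Equiv.prodCongr (c γ).toEquiv (c γ).toEquiv
      map_one' := by ext p <;> simp
      map_mul' := fun γ δ => by ext p <;> simp }
  obtain ⟨d, hd⟩ := (h.isBaseInjective.tensorEval h.isBaseInjective).exists_eq_of_fixed (Γ := Γ)
    (by rw [Module.finrank_tensorProduct, h.finite_and_finrank.2, Fintype.card_prod]) c'
    (fun d γ p => h.tensorEval_conj d γ p.1 p.2)
    (fun p : N × N => if p.1 = p.2 then cf a p.1 else 0) (by
      rintro γ ⟨n, n'⟩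
      simp only [c', MonoidHom.coe_mk, OneHom.coe_mk, Equiv.prodCongr_apply, Prod.map,
        MulEquiv.toEquiv_eq_coe, EquivLike.coe_coe, EmbeddingLike.apply_eq_iff_eq, h.map_conj]
      split_ifs <;> simp)
  exact ⟨d, fun n n' => by rw [hd]⟩

theorem exists_counit (a : A) : ∃ k : K, algebraMap K L k = ∑ n, cf a n := by
  refine mem_range_algebraMap_of_smul_eq (Γ := Γ) _ fun γ => ?_
  rw [Finset.smul_sum]
  exact Fintype.sum_equiv (c γ).toEquiv _ _ fun n => (h.map_conj a γ n).symm

theorem exists_antipode (a : A) : ∃ a' : A, ∀ n, cf a' n = cf a n⁻¹ := by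
  obtain ⟨a', ha'⟩ := (h.mem_range fun n => cf a n⁻¹).2 fun γ n => by rw [← map_inv, h.map_conj]
  exact ⟨a', fun n => by rw [ha']⟩

/-- The function underlying the comultiplication. -/
def comulFun (a : A) : A ⊗[K] A := (h.exists_comul a).choose

theorem tensorEval_comulFun (a : A) (n n' : N) :
    tensorEval cf cf (h.comulFun a) (n, n') = if n = n' then cf a n else 0 :=
  (h.exists_comul a).choose_spec n n'

/-- The comultiplication, `n ↦ n ⊗ n`. -/
def comul : A →ₐ[K] A ⊗[K] A :=
  AlgHom.ofLinearMap
    { toFun := h.comulFun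
      map_add' := fun a b => h.tensor_injective <| by
        ext ⟨n, n'⟩
        simp only [map_add, Pi.add_apply, h.tensorEval_comulFun]
        split_ifs <;> simp
      map_smul' := fun k a => h.tensor_injective <| by
        ext ⟨n, n'⟩
        simp only [map_smul, Pi.smul_apply, h.tensorEval_comulFun, RingHom.id_apply]
        split_ifs <;> simp }
    (h.tensor_injective <| by
      ext ⟨n, n'⟩
      simp only [LinearMap.coe_mk, AddHom.coe_mk, h.tensorEval_comulFun,
        Algebra.TensorProduct.one_def, tensorEval_tmul, h.map_one]
      split_ifs <;> simp_all)
    (fun a b => h.tensor_injective <| by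
      ext ⟨n, n'⟩
      simp only [LinearMap.coe_mk, AddHom.coe_mk, h.tensorEval_comulFun, h.map_mul,
        h.tensorEval_mul, ite_mul, zero_mul, Finset.sum_ite_eq, Finset.mem_univ, if_true,
        mul_right_inj]
      split_ifs <;> simp)

theorem tensorEval_comul (a : A) (n n' : N) :
    tensorEval cf cf (h.comul a) (n, n') = if n = n' then cf a n else 0 :=
  h.tensorEval_comulFun a n n'

/-- The function underlying the counit. -/
def counitFun (a : A) : K := (h.exists_counit a).choose

theorem algebraMap_counitFun (a : A) : algebraMap K L (h.counitFun a) = ∑ n, cf a n :=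
  (h.exists_counit a).choose_spec

/-- The counit, `n ↦ 1`. -/
def counit : A →ₐ[K] K :=
  AlgHom.ofLinearMap
    { toFun := h.counitFun
      map_add' := fun a b => (algebraMap K L).injective <| by
        simp only [map_add, Pi.add_apply, h.algebraMap_counitFun, Finset.sum_add_distrib]
      map_smul' := fun k a => (algebraMap K L).injective <| by
        simp only [map_smul, Pi.smul_apply, h.algebraMap_counitFun, RingHom.id_apply,
          smul_eq_mul, _root_.map_mul, Finset.mul_sum, Algebra.smul_def (A := L)] }
    ((algebraMap K L).injective <| by
      simp [h.algebraMap_counitFun, h.map_one])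
    (fun a b => (algebraMap K L).injective <| by
      simp only [LinearMap.coe_mk, AddHom.coe_mk, h.algebraMap_counitFun, h.map_mul,
        _root_.map_mul, Finset.sum_mul_sum]
      rw [Finset.sum_comm]
      exact Finset.sum_congr rfl fun m _ => Fintype.sum_equiv (Equiv.mulLeft m⁻¹) _ _ fun n => rfl)

theorem algebraMap_counit (a : A) : algebraMap K L (h.counit a) = ∑ n, cf a n :=
  h.algebraMap_counitFun a

/-- The function underlying the antipode. -/
def antipodeFun (a : A) : A := (h.exists_antipode a).choose

theorem antipodeFun_apply (a : A) (n : N) : cf (h.antipodeFun a) n = cf a n⁻¹ :=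
  (h.exists_antipode a).choose_spec n

/-- The antipode, `n ↦ n⁻¹`. -/
def antipode : A →ₗ[K] A where
  toFun := h.antipodeFun
  map_add' a b := h.injective <| by
    ext n
    simp only [map_add, Pi.add_apply, h.antipodeFun_apply]
  map_smul' k a := h.injective <| by
    ext n
    simp only [map_smul, Pi.smul_apply, h.antipodeFun_apply, RingHom.id_apply]

theorem antipode_apply (a : A) (n : N) : cf (h.antipode a) n = cf a n⁻¹ :=
  h.antipodeFun_apply a n

theorem coassoc : (Algebra.TensorProduct.assoc K K K A A A).toAlgHom.comp
    ((Algebra.TensorProduct.map h.comul (.id K A)).comp h.comul) =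
      (Algebra.TensorProduct.map (.id K A) h.comul).comp h.comul := by
  ext a
  -- Both sides are compared as functions on `N × N × N`, where each is `cf a` on the diagonal and
  -- zero elsewhere.
  refine (h.isBaseInjective.tensorEval
    (h.isBaseInjective.tensorEval h.isBaseInjective)).injective ?_
  ext ⟨n, n', n''⟩
  have h0 : ∀ (d : A ⊗[K] A) (b : A), tensorEval cf (tensorEval cf cf)
      (Algebra.TensorProduct.assoc K K K A A A (d ⊗ₜ b)) (n, n', n'') =
        tensorEval cf cf d (n, n') * cf b n'' := by
    intro d b
    induction d with
    | zero => simp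
    | add x y hx hy => simp only [TensorProduct.add_tmul, map_add, Pi.add_apply, hx, hy, add_mul]
    | tmul x y => simp [mul_assoc]
  have h1 : ∀ d : A ⊗[K] A, tensorEval cf (tensorEval cf cf)
      (Algebra.TensorProduct.assoc K K K A A A
        (Algebra.TensorProduct.map h.comul (.id K A) d)) (n, n', n'') =
        if n = n' then tensorEval cf cf d (n, n'') else 0 := by
    intro d
    induction d with
    | zero => simp
    | add x y hx hy =>
      simp only [map_add, Pi.add_apply, hx, hy]
      split_ifs <;> simp
    | tmul x y =>
      rw [Algebra.TensorProduct.map_tmul, h0, h.tensorEval_comul]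
      simp
  have h2 : ∀ d : A ⊗[K] A, tensorEval cf (tensorEval cf cf)
        (Algebra.TensorProduct.map (.id K A) h.comul d) (n, n', n'') =
        if n' = n'' then tensorEval cf cf d (n, n') else 0 := by
    intro d
    induction d with
    | zero => simp
    | add x y hx hy =>
      simp only [map_add, Pi.add_apply, hx, hy]
      split_ifs <;> simp
    | tmul x y =>
      rw [Algebra.TensorProduct.map_tmul, tensorEval_tmul]
      simp [h.tensorEval_comul]
  refine (h1 (h.comul a)).trans (Eq.trans ?_ (h2 (h.comul a)).symm)
  simp only [h.tensorEval_comul]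
  split_ifs <;> simp_all

theorem counit_comul_left : (Algebra.TensorProduct.map h.counit (.id K A)).comp h.comul =
    (Algebra.TensorProduct.lid K A).symm := by
  ext a
  apply (Algebra.TensorProduct.lid K A).injective
  apply h.injective
  ext n
  have h1 : ∀ d : A ⊗[K] A, cf (Algebra.TensorProduct.lid K A
      (Algebra.TensorProduct.map h.counit (.id K A) d)) n =
        ∑ m, tensorEval cf cf d (m, n) := by
    intro d
    induction d with
    | zero => simp
    | add x y hx hy => simp only [map_add, Pi.add_apply, hx, hy, Finset.sum_add_distrib]
    | tmul x y =>
      simp [← Finset.sum_mul, ← h.algebraMap_counit, Algebra.smul_def (A := L)]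
  refine (h1 _).trans ?_
  simp [h.tensorEval_comul]

theorem counit_comul_right : (Algebra.TensorProduct.map (.id K A) h.counit).comp h.comul =
    (Algebra.TensorProduct.rid K K A).symm := by
  ext a
  apply (Algebra.TensorProduct.rid K K A).injective
  apply h.injective
  ext n
  have h1 : ∀ d : A ⊗[K] A, cf (Algebra.TensorProduct.rid K K A
      (Algebra.TensorProduct.map (.id K A) h.counit d)) n =
        ∑ m, tensorEval cf cf d (n, m) := by
    intro d
    induction d with
    | zero => simp
    | add x y hx hy => simp only [map_add, Pi.add_apply, hx, hy, Finset.sum_add_distrib]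
    | tmul x y =>
      simp [← Finset.mul_sum, ← h.algebraMap_counit, Algebra.smul_def (A := L), mul_comm]
  refine (h1 _).trans ?_
  simp [h.tensorEval_comul]

theorem map_algebraMap (k : K) (n : N) :
    cf (algebraMap K A k) n = if n = 1 then algebraMap K L k else 0 := by
  rw [Algebra.algebraMap_eq_smul_one, map_smul, Pi.smul_apply, h.map_one, Algebra.smul_def]
  simp

theorem mul_antipode_left (a : A) :
    LinearMap.mul' K A (h.antipode.rTensor A (h.comul a)) = algebraMap K A (h.counit a) := by
  apply h.injective
  ext n
  have h1 : ∀ d : A ⊗[K] A, cf (LinearMap.mul' K A (h.antipode.rTensor A d)) n =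
      ∑ m, tensorEval cf cf d (m, m * n) := by
    intro d
    induction d with
    | zero => simp
    | add x y hx hy => simp only [map_add, Pi.add_apply, hx, hy, Finset.sum_add_distrib]
    | tmul x y =>
      rw [LinearMap.rTensor_tmul, LinearMap.mul'_apply, h.map_mul]
      refine Fintype.sum_equiv (Equiv.inv N) _ _ fun m => ?_
      simp [h.antipode_apply]
  rw [h1, h.map_algebraMap, h.algebraMap_counit]
  simp [h.tensorEval_comul]

theorem mul_antipode_right (a : A) :
    LinearMap.mul' K A (h.antipode.lTensor A (h.comul a)) = algebraMap K A (h.counit a) := by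
  apply h.injective
  ext n
  have h1 : ∀ d : A ⊗[K] A, cf (LinearMap.mul' K A (h.antipode.lTensor A d)) n =
      ∑ m, tensorEval cf cf d (m, n⁻¹ * m) := by
    intro d
    induction d with
    | zero => simp
    | add x y hx hy => simp only [map_add, Pi.add_apply, hx, hy, Finset.sum_add_distrib]
    | tmul x y =>
      rw [LinearMap.lTensor_tmul, LinearMap.mul'_apply, h.map_mul]
      refine Finset.sum_congr rfl fun m _ => ?_
      simp [h.antipode_apply]
  rw [h1, h.map_algebraMap, h.algebraMap_counit]
  simp [h.tensorEval_comul]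

/-- The Hopf algebra structure on a form of a group algebra. -/
@[reducible] def hopfAlgebra : HopfAlgebra K A where
  __ := Bialgebra.ofAlgHom h.comul h.counit h.coassoc h.counit_comul_left h.counit_comul_right
  antipode := h.antipode
  mul_antipode_rTensor_comul := LinearMap.ext h.mul_antipode_left
  mul_antipode_lTensor_comul := LinearMap.ext h.mul_antipode_right

end IsFixedGroupAlgebra

/-! ### Greither–Pareigis: from permutation groups to Hopf Galois structures -/

section

variable {K M L Γ X : Type*} [Field K] [Field M] [Field L] [Algebra K M] [Algebra K L] [Algebra M L]
  [IsScalarTower K M L] [Group Γ] [Finite Γ] [MulSemiringAction Γ L] [hG : IsGaloisGroup Γ K L]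
  [One X] {lam : Γ →* Equiv.Perm X} {rep : X → Γ} {N : Subgroup (Equiv.Perm X)}
  [Fintype N] [DecidableEq N]

/-- The action of a function on a group of permutations of the coset space, evaluated at a
coset. -/
def cosetEval (L : Type*) [Field L] [MulSemiringAction Γ L] [Algebra M L] (rep : X → Γ) (f : N → L)
    (x : X) (m : M) : L :=
  ∑ n : N, f n * rep ((n : Equiv.Perm X)⁻¹ x) • algebraMap M L m

theorem cosetEval_add_left (f g : N → L) (x : X) (m : M) :
    cosetEval L rep (f + g) x m = cosetEval L rep f x m + cosetEval L rep g x m := by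
  simp [cosetEval, add_mul, Finset.sum_add_distrib]

theorem cosetEval_smul_left (k : K) (f : N → L) (x : X) (m : M) :
    cosetEval L rep (k • f) x m = k • cosetEval L rep f x m := by
  simp [cosetEval, Finset.smul_sum]

theorem cosetEval_add_right (f : N → L) (x : X) (m m' : M) :
    cosetEval L rep f x (m + m') = cosetEval L rep f x m + cosetEval L rep f x m' := by
  simp [cosetEval, mul_add, Finset.sum_add_distrib]

include hG in
theorem cosetEval_smul_right (f : N → L) (x : X) (k : K) (m : M) :
    cosetEval L rep f x (k • m) = algebraMap K L k * cosetEval L rep f x m := by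
  rw [cosetEval, cosetEval, Finset.mul_sum]
  refine Finset.sum_congr rfl fun n _ => ?_
  rw [Algebra.smul_def, map_mul, ← IsScalarTower.algebraMap_apply, smul_mul', smul_algebraMap_eq]
  ring

namespace IsCosetSystem

variable (hX : IsCosetSystem K M L lam rep)
  (hnorm : lam.range ≤ Subgroup.normalizer (N : Set (Equiv.Perm X)))

include hX in
-- Reindexing the sum by conjugation trades `γ` for a translation of the coset. The value at the
-- base point is therefore fixed by its stabilizer and lies in `M`.
theorem smul_cosetEval {f : N → L} (hf : ∀ γ n, f (conjHom hnorm γ n) = γ • f n) (γ : Γ) (x : X)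
    (m : M) : γ • cosetEval L rep f x m = cosetEval L rep f (lam γ x) m := by
  rw [cosetEval, cosetEval, Finset.smul_sum]
  refine Fintype.sum_equiv (conjHom hnorm γ).toEquiv _ _ fun n => ?_
  change _ = f (conjHom hnorm γ n) * _
  rw [hf, smul_mul', ← hX.rep_lam]
  congr 3
  change _ = ((conjHom hnorm γ n : N) : Equiv.Perm X)⁻¹ (lam γ x)
  simp

include hX in
theorem exists_algebraMap_eq_cosetEval {f : N → L} (hf : ∀ γ n, f (conjHom hnorm γ n) = γ • f n)
    (m : M) : ∃ m' : M, algebraMap M L m' = cosetEval L rep f 1 m :=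
  hX.fixed _ fun γ hγ => by rw [hX.smul_cosetEval hnorm hf, hγ]

variable {A : Type*} [Ring A] [Algebra K A] {cf : A →ₗ[K] N → L}
  (h : IsFixedGroupAlgebra (conjHom hnorm) cf)

/-- The function underlying the action of a form of a group algebra. -/
def actFun (a : A) (m : M) : M :=
  (hX.exists_algebraMap_eq_cosetEval hnorm (h.map_conj a) m).choose

theorem algebraMap_actFun (a : A) (m : M) :
    algebraMap M L (hX.actFun hnorm h a m) = cosetEval L rep (cf a) 1 m :=
  (hX.exists_algebraMap_eq_cosetEval hnorm (h.map_conj a) m).choose_spec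

/-- The action of a form of a group algebra. -/
def act : A →ₐ[K] Module.End K M :=
  AlgHom.ofLinearMap
    { toFun := fun a =>
        { toFun := hX.actFun hnorm h a
          map_add' := fun m m' => (algebraMap M L).injective <| by
            simp only [map_add, hX.algebraMap_actFun, cosetEval_add_right]
          map_smul' := fun k m => (algebraMap M L).injective <| by
            rw [hX.algebraMap_actFun, cosetEval_smul_right, RingHom.id_apply,
              Algebra.smul_def, map_mul, hX.algebraMap_actFun, ← IsScalarTower.algebraMap_apply] }
      map_add' := fun a b => LinearMap.ext fun m => (algebraMap M L).injective <| by
        simp only [LinearMap.coe_mk, AddHom.coe_mk, LinearMap.add_apply, map_add,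
          hX.algebraMap_actFun, cosetEval_add_left]
      map_smul' := fun k a => LinearMap.ext fun m => (algebraMap M L).injective <| by
        simp only [LinearMap.coe_mk, AddHom.coe_mk, LinearMap.smul_apply, map_smul,
          hX.algebraMap_actFun, cosetEval_smul_left, RingHom.id_apply, algebraMap.coe_smul] }
    (LinearMap.ext fun m => (algebraMap M L).injective <| by
      simpa [hX.algebraMap_actFun, cosetEval, h.map_one] using
        show rep (Equiv.symm (1 : Equiv.Perm X) 1) • algebraMap M L m = _ from hX.rep_one m)
    (fun a b => LinearMap.ext fun m => (algebraMap M L).injective <| by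
      simp only [LinearMap.coe_mk, AddHom.coe_mk, Module.End.mul_apply, hX.algebraMap_actFun]
      rw [cosetEval, cosetEval]
      simp only [h.map_mul, Finset.sum_mul]
      rw [Finset.sum_comm]
      refine Finset.sum_congr rfl fun k _ => ?_
      -- The inner action is computed at the coset `1`; applying `rep (k⁻¹ 1)` moves it to the coset
      -- `k⁻¹ 1`, so the double sum becomes a convolution.
      rw [hX.algebraMap_actFun, hX.smul_cosetEval hnorm (h.map_conj b), hX.lam_rep, cosetEval,
        Finset.mul_sum]
      refine Fintype.sum_equiv (Equiv.mulLeft k⁻¹) _ _ fun n => ?_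
      simp [mul_assoc])

theorem algebraMap_act (a : A) (m : M) :
    algebraMap M L (hX.act hnorm h a m) = cosetEval L rep (cf a) 1 m :=
  hX.algebraMap_actFun hnorm h a m

theorem act_apply_one (a : A) :
    hX.act hnorm h a 1 = algebraMap K M (h.counit a) := by
  refine (algebraMap M L).injective ?_
  rw [algebraMap_act, ← IsScalarTower.algebraMap_apply, h.algebraMap_counit]
  simp [cosetEval]

theorem act_apply_mul (a : A) (x y : M) : hX.act hnorm h a (x * y) =
    tensorEval (repFun (hX.act hnorm h)) (repFun (hX.act hnorm h)) (h.comul a) (x, y) := by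
  refine (algebraMap M L).injective ?_
  have h1 : ∀ d : A ⊗[K] A, algebraMap M L
      (tensorEval (repFun (hX.act hnorm h)) (repFun (hX.act hnorm h)) d (x, y)) =
      ∑ n, ∑ n', tensorEval cf cf d (n, n') *
        (rep ((n : Equiv.Perm X)⁻¹ 1) • algebraMap M L x *
          rep ((n' : Equiv.Perm X)⁻¹ 1) • algebraMap M L y) := by
    intro d
    induction d with
    | zero => simp
    | add x y hx hy =>
      simp only [map_add, Pi.add_apply, hx, hy, Finset.sum_add_distrib, add_mul]
    | tmul a b =>
      rw [tensorEval_tmul, map_mul, repFun_apply, repFun_apply, algebraMap_act, algebraMap_act,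
        cosetEval, cosetEval, Finset.sum_mul_sum]
      refine Finset.sum_congr rfl fun n _ => Finset.sum_congr rfl fun n' _ => ?_
      rw [tensorEval_tmul]
      ring
  rw [h1, algebraMap_act, cosetEval]
  simp only [h.tensorEval_comul, ite_mul, zero_mul, Finset.sum_ite_eq, Finset.mem_univ, if_true,
    map_mul, smul_mul']

variable [FiniteDimensional K M]

/-- A relation among the actions of a basis is a relation among the distinct embeddings given by the
points `n⁻¹ 1`. Dedekind makes its coefficients vanish for every `n`, and `cf` is base-injective;
the dimensions agree. -/
theorem galoisMap_act_bijective (hN : IsRegularPermGroup N) :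
    Function.Bijective (galoisMap (hX.act hnorm h)) := by
  have := h.finite_and_finrank.1
  refine galoisMap_bijective_of _ ?_ ?_
  · let b := Module.finBasis K A
    rw [isBaseInjective_iff_linearIndependent b, Fintype.linearIndependent_iff]
    intro c hc
    have hb := (isBaseInjective_iff_linearIndependent b).1 h.isBaseInjective
    have hli := hX.linearIndependent.comp _ (hN.inv_apply_injective 1)
    rw [Fintype.linearIndependent_iff] at hb hli
    have hzero := hli (fun n => ∑ i, algebraMap M L (c i) * cf (b i) n) (by
      ext m
      have := congrArg (algebraMap M L) (congrFun hc m)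
      simp only [Finset.sum_apply, Pi.smul_apply, smul_eq_mul, repFun_apply, map_sum, map_mul,
        hX.algebraMap_act, cosetEval, Pi.zero_apply, map_zero, Finset.mul_sum] at this
      rw [Finset.sum_comm] at this
      simpa [Finset.sum_mul, mul_assoc] using this)
    intro i
    have := hb (fun i => algebraMap M L (c i)) (by
      ext n
      simpa [Algebra.smul_def] using hzero n) i
    simpa using this
  · rw [h.finite_and_finrank.2, ← Nat.card_eq_fintype_card, hN.card, hX.card]

/-- The Hopf Galois structure given by a form of the group algebra of a regular group of
permutations. -/
def hopfGaloisStructure (hN : IsRegularPermGroup N) : HopfGaloisStructure K M :=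
  letI := h.hopfAlgebra
  { H := A
    act := hX.act hnorm h
    act_one := hX.act_apply_one hnorm h
    act_mul := fun a x y => by
      rw [HopfGaloisStructure.mul'_map_flip_eq_tensorEval]
      exact hX.act_apply_mul hnorm h a x y
    bijective := hX.galoisMap_act_bijective hnorm h hN }

end IsCosetSystem

end

section

universe v

variable {K M L Γ X : Type*} [Field K] [Field M] [Field L] [Algebra K M] [Algebra K L] [Algebra M L]
  [IsScalarTower K M L] [Group Γ] [Finite Γ] [MulSemiringAction Γ L] [hG : IsGaloisGroup Γ K L]
  [One X] {lam : Γ →* Equiv.Perm X} {rep : X → Γ} {N : Subgroup (Equiv.Perm X)}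
  [FiniteDimensional K M]

/-- The other half of the Greither-Pareigis correspondence: a regular group of permutations
normalized by the Galois group gives a Hopf Galois structure, on any form of the Hopf algebra. -/
theorem IsCosetSystem.exists_hopfGaloisStructure (hX : IsCosetSystem K M L lam rep)
    (hnorm : lam.range ≤ Subgroup.normalizer (N : Set (Equiv.Perm X)))
    (hN : IsRegularPermGroup N) {A : Type v} [Ring A] [Algebra K A]
    (i : A →ₐ[K] MonoidAlgebra L N) (hi : Function.Injective i)
    (hrange : Set.range i = fixedGroupAlgebra L lam N) :
    ∃ (S : HopfGaloisStructure.{v} K M) (e : S.H ≃ₐ[K] A), ∀ h m,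
      algebraMap M L (S.act h m) = (i (e h)).coeff.sum fun n c =>
        c * (rep ((n : Equiv.Perm X)⁻¹ 1) • algebraMap M L m) := by
  classical
  have := hX.finite
  have := Fintype.ofFinite N
  let cf : A →ₗ[K] N → L :=
    { toFun := fun a n => (i a).coeff n
      map_add' := fun a b => by ext; simp
      map_smul' := fun k a => by ext; simp }
  have hcf : ∀ a n, cf a n = (i a).coeff n := fun _ _ => rfl
  have h : IsFixedGroupAlgebra (conjHom hnorm) cf :=
    { map_one := fun n => by
        rw [hcf, map_one, MonoidAlgebra.one_def, MonoidAlgebra.coeff_single, Finsupp.single_apply]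
        simp [eq_comm]
      map_mul := fun a b n => by
        simp only [hcf, map_mul, MonoidAlgebra.coeff_mul_apply_left]
        exact Finsupp.sum_fintype _ _ (by simp)
      injective := fun a b hab => hi (MonoidAlgebra.coeff_injective
        (Finsupp.ext fun n => congrFun hab n))
      mem_range := fun f => by
        let x : MonoidAlgebra L N := .ofCoeff (Finsupp.equivFunOnFinite.symm f)
        have hx : ∀ n, x.coeff n = f n := fun n => rfl
        have h1 := mem_fixedGroupAlgebra_iff hnorm x
        rw [← hrange] at h1
        simp only [hx] at h1
        rw [← h1]
        constructor
        · rintro ⟨a, rfl⟩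
          exact ⟨a, MonoidAlgebra.coeff_injective (Finsupp.ext fun n => rfl)⟩
        · rintro ⟨a, ha⟩
          exact ⟨a, by ext n; rw [hcf, ha, hx]⟩ }
  refine ⟨hX.hopfGaloisStructure hnorm h hN, AlgEquiv.refl, fun a m => ?_⟩
  rw [Finsupp.sum_fintype _ _ (by simp)]
  exact hX.algebraMap_act hnorm h a m

end

theorem IsBaseInjective.of_comp {k Q V X Y : Type*} [Field k] [Field Q] [Algebra k Q]
    [AddCommGroup V] [Module k V] {f : V →ₗ[k] X → Q} (p : Y → X) {g : V →ₗ[k] Y → Q}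
    (hg : IsBaseInjective g) (hfg : ∀ v y, g v y = f v (p y)) : IsBaseInjective f := by
  let b := Module.Basis.ofVectorSpace k V
  rw [isBaseInjective_iff_linearIndependent b] at hg ⊢
  refine LinearIndependent.of_comp (LinearMap.funLeft Q Q p) ?_
  convert! hg using 1
  ext i y
  simp [hfg, LinearMap.funLeft_apply]

/-! ### Tensor products of Hopf Galois structures -/

section

variable {K L : Type*} [Field K] [Field L] [Algebra K L]

@[simp] theorem mulTensor_tmul (E F : IntermediateField K L) (α : E) (z : F) :
    mulTensor E F (α ⊗ₜ z) = (α : L) * z := by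
  simp [mulTensor]

@[simp] theorem kroneckerRep_tmul {A₁ A₂ V₁ V₂ : Type*} [Ring A₁] [Algebra K A₁] [Ring A₂]
    [Algebra K A₂] [AddCommGroup V₁] [Module K V₁] [AddCommGroup V₂] [Module K V₂]
    (ρ₁ : A₁ →ₐ[K] Module.End K V₁) (ρ₂ : A₂ →ₐ[K] Module.End K V₂) (a : A₁) (b : A₂)
    (v : V₁) (w : V₂) : kroneckerRep ρ₁ ρ₂ (a ⊗ₜ b) (v ⊗ₜ w) = ρ₁ a v ⊗ₜ ρ₂ b w := by
  simp [kroneckerRep, Module.endTensorEndAlgHom_apply]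

theorem tensorEval_repFun_add_left {M H : Type*} [Field M] [Algebra K M] [Ring H] [Algebra K H]
    (ρ : H →ₐ[K] Module.End K M) (d : H ⊗[K] H) (x x' y : M) :
    tensorEval (repFun ρ) (repFun ρ) d (x + x', y) =
      tensorEval (repFun ρ) (repFun ρ) d (x, y) + tensorEval (repFun ρ) (repFun ρ) d (x', y) := by
  simp only [← HopfGaloisStructure.mul'_map_flip_eq_tensorEval]
  simp [TensorProduct.map_add_left]

theorem tensorEval_repFun_add_right {M H : Type*} [Field M] [Algebra K M] [Ring H] [Algebra K H]
    (ρ : H →ₐ[K] Module.End K M) (d : H ⊗[K] H) (x y y' : M) :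
    tensorEval (repFun ρ) (repFun ρ) d (x, y + y') =
      tensorEval (repFun ρ) (repFun ρ) d (x, y) + tensorEval (repFun ρ) (repFun ρ) d (x, y') := by
  simp only [← HopfGaloisStructure.mul'_map_flip_eq_tensorEval]
  simp [TensorProduct.map_add_right]

theorem tensorEval_repFun_zero_left {M H : Type*} [Field M] [Algebra K M] [Ring H] [Algebra K H]
    (ρ : H →ₐ[K] Module.End K M) (d : H ⊗[K] H) (y : M) :
    tensorEval (repFun ρ) (repFun ρ) d (0, y) = 0 := by
  have := tensorEval_repFun_add_left ρ d 0 0 y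
  simpa using this

theorem tensorEval_repFun_zero_right {M H : Type*} [Field M] [Algebra K M] [Ring H] [Algebra K H]
    (ρ : H →ₐ[K] Module.End K M) (d : H ⊗[K] H) (x : M) :
    tensorEval (repFun ρ) (repFun ρ) d (x, 0) = 0 := by
  have := tensorEval_repFun_add_right ρ d x 0 0
  simpa using this

/-- Additive functions of two variables in `L = EF` agree if they agree on products. -/
theorem induction_mulTensor {E F : IntermediateField K L} (hEF : Function.Surjective (mulTensor E F))
    {p : L → Prop} (x : L) (zero : p 0) (add : ∀ x y, p x → p y → p (x + y))
    (mul : ∀ (α : E) (z : F), p (α * z)) : p x := by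
  obtain ⟨t, rfl⟩ := hEF x
  induction t with
  | zero => simpa using zero
  | add a b ha hb => rw [map_add]; exact add _ _ ha hb
  | tmul α z => rw [mulTensor_tmul]; exact mul α z

namespace HopfGaloisStructure

variable {E F : IntermediateField K L} (hEF : Function.Bijective (mulTensor E F))
  (S : HopfGaloisStructure K E) (T : HopfGaloisStructure K F)

/-- The Kronecker product of two Hopf actions, transported to `L = E ⊗ F`. -/
def kroneckerAct : S.H ⊗[K] T.H →ₐ[K] Module.End K L :=
  ((AlgEquiv.ofBijective _ hEF).toLinearEquiv.conjAlgEquiv K).toAlgHom.comp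
    (kroneckerRep S.act T.act)

theorem kroneckerAct_mulTensor (h : S.H ⊗[K] T.H) (t : E ⊗[K] F) :
    kroneckerAct hEF S T h (mulTensor E F t) = mulTensor E F (kroneckerRep S.act T.act h t) := by
  have h1 : (AlgEquiv.ofBijective _ hEF).symm (mulTensor E F t) = t :=
    (AlgEquiv.ofBijective _ hEF).symm_apply_apply t
  change mulTensor E F (kroneckerRep S.act T.act h
    ((AlgEquiv.ofBijective _ hEF).symm (mulTensor E F t))) = _
  rw [h1]

theorem kroneckerAct_tmul (a : S.H) (b : T.H) (α : E) (z : F) :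
    kroneckerAct hEF S T (a ⊗ₜ b) ((α : L) * z) = (S.act a α : L) * (T.act b z : L) := by
  rw [← mulTensor_tmul, kroneckerAct_mulTensor, kroneckerRep_tmul, mulTensor_tmul]

/-- A Hopf action on an intermediate field, as a space of functions with values in `L`. -/
def valFun (S : HopfGaloisStructure K E) : S.H →ₗ[K] E → L :=
  (E.val.toLinearMap.compLeft E) ∘ₗ repFun S.act

@[simp] theorem valFun_apply (S : HopfGaloisStructure K E) (h : S.H) (x : E) :
    S.valFun h x = S.act h x := rfl

theorem isBaseInjective_valFun (S : HopfGaloisStructure K E) : IsBaseInjective S.valFun :=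
  S.isBaseInjective_repFun.extend fun _ _ => rfl

theorem kroneckerAct_mul (h : S.H ⊗[K] T.H) (α : E) (z : F) :
    kroneckerAct hEF S T h ((α : L) * z) = tensorEval S.valFun T.valFun h (α, z) := by
  induction h with
  | zero => simp
  | add a b ha hb => simp only [map_add, LinearMap.add_apply, ha, hb, Pi.add_apply]
  | tmul a b => rw [kroneckerAct_tmul, tensorEval_tmul, valFun_apply, valFun_apply]

/-- Restricted to products `αz`, the Kronecker action is the `tensorEval` of the two actions, and
its values there already determine the element after extension of scalars. -/
theorem isBaseInjective_kroneckerAct : IsBaseInjective (repFun (kroneckerAct hEF S T)) :=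
  IsBaseInjective.of_comp (fun p : E × F => (p.1 : L) * p.2)
    (S.isBaseInjective_valFun.tensorEval T.isBaseInjective_valFun)
    fun h p => (kroneckerAct_mul hEF S T h p.1 p.2).symm

theorem kroneckerAct_one (h : S.H ⊗[K] T.H) :
    kroneckerAct hEF S T h 1 = algebraMap K L (Coalgebra.counit h) := by
  have h1 := kroneckerAct_mul hEF S T h 1 1
  rw [OneMemClass.coe_one, OneMemClass.coe_one, mul_one] at h1
  rw [h1]
  clear h1
  induction h with
  | zero => simp
  | add a b ha hb => simp only [map_add, Pi.add_apply, ha, hb]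
  | tmul a b =>
    rw [tensorEval_tmul, valFun_apply, valFun_apply, S.act_one, T.act_one,
      TensorProduct.counit_tmul, smul_eq_mul, map_mul, mul_comm]
    rfl

theorem kroneckerAct_mul_mul (h : S.H ⊗[K] T.H) (x y : L) :
    kroneckerAct hEF S T h (x * y) = tensorEval (repFun (kroneckerAct hEF S T))
      (repFun (kroneckerAct hEF S T)) (Coalgebra.comul (R := K) h) (x, y) := by
  induction x using induction_mulTensor hEF.2 with
  | zero => rw [zero_mul, map_zero, tensorEval_repFun_zero_left]
  | add x x' hx hx' => rw [add_mul, map_add, tensorEval_repFun_add_left, hx, hx']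
  | mul α z =>
    induction y using induction_mulTensor hEF.2 with
    | zero => rw [mul_zero, map_zero, tensorEval_repFun_zero_right]
    | add x x' hx hx' => rw [mul_add, map_add, tensorEval_repFun_add_right, hx, hx']
    | mul β w =>
      induction h with
      | zero => simp
      | add a b ha hb => simp only [map_add, LinearMap.add_apply, Pi.add_apply, ha, hb]
      | tmul a b =>
        -- The comultiplication of `a ⊗ b` interleaves those of `a` and `b`; the formula is proved
        -- for arbitrary tensors in their place so that induction applies.
        have h1 : ∀ (d : S.H ⊗[K] S.H) (d' : T.H ⊗[K] T.H),
            tensorEval (repFun (kroneckerAct hEF S T)) (repFun (kroneckerAct hEF S T))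
              (TensorProduct.AlgebraTensorModule.tensorTensorTensorComm K K K K S.H S.H T.H T.H
                (d ⊗ₜ d')) ((α : L) * z, (β : L) * w) =
              (tensorEval (repFun S.act) (repFun S.act) d (α, β) : E) *
              ((tensorEval (repFun T.act) (repFun T.act) d' (z, w) : F) : L) := by
          intro d d'
          induction d with
          | zero => simp
          | add a b ha hb =>
            simp only [TensorProduct.add_tmul, map_add, Pi.add_apply, ha, hb,
              AddMemClass.coe_add, add_mul]
          | tmul a b =>
            induction d' with
            | zero => simp
            | add a b ha hb =>
              simp only [TensorProduct.tmul_add, map_add, Pi.add_apply, ha, hb,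
                AddMemClass.coe_add, mul_add]
            | tmul a' b' =>
              simp only [TensorProduct.AlgebraTensorModule.tensorTensorTensorComm_tmul,
                tensorEval_tmul, repFun_apply, kroneckerAct_tmul, MulMemClass.coe_mul]
              ring
        rw [TensorProduct.comul_tmul, h1, ← act_mul_eq_tensorEval, ← act_mul_eq_tensorEval,
          ← kroneckerAct_tmul hEF]
        congr 1
        simp only [MulMemClass.coe_mul]
        ring

variable [FiniteDimensional K L]

/-- The tensor product of Hopf Galois structures on `E` and `F`, on `L = E ⊗ F`. -/
def tensorProduct : HopfGaloisStructure K L where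
  H := S.H ⊗[K] T.H
  act := kroneckerAct hEF S T
  act_one := kroneckerAct_one hEF S T
  act_mul h x y := by
    rw [mul'_map_flip_eq_tensorEval]
    exact kroneckerAct_mul_mul hEF S T h x y
  bijective := by
    refine galoisMap_bijective_of _ (isBaseInjective_kroneckerAct hEF S T) ?_
    rw [Module.finrank_tensorProduct, S.finrank_eq, T.finrank_eq,
      ← (AlgEquiv.ofBijective _ hEF).toLinearEquiv.finrank_eq, Module.finrank_tensorProduct]

theorem isTensorProduct_of_isIso {S' : HopfGaloisStructure K L}
    (h : (tensorProduct hEF S T).IsIso S') : S'.IsTensorProduct S T := by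
  obtain ⟨e, he⟩ := h
  refine ⟨e, fun h t => ?_⟩
  rw [← kroneckerAct_mulTensor hEF]
  exact he h _

end HopfGaloisStructure

end

/-! ### The algebra `L[N]^Γ` and existence of structures -/

section FixedSubalgebra

variable {K L Γ X : Type*} [Field K] [Field L] [Algebra K L] [Group Γ]
  [MulSemiringAction Γ L] [hG : IsGaloisGroup Γ K L] {lam : Γ →* Equiv.Perm X}
  {N : Subgroup (Equiv.Perm X)} [Finite X]

variable (K L) in
/-- The algebra `L[N]^Γ`. -/
def fixedSubalgebra (hnorm : lam.range ≤ Subgroup.normalizer (N : Set (Equiv.Perm X))) :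
    Subalgebra K (MonoidAlgebra L N) where
  carrier := fixedGroupAlgebra L lam N
  mul_mem' {a b} ha hb := by
    have := Fintype.ofFinite N
    rw [mem_fixedGroupAlgebra_iff hnorm] at ha hb ⊢
    intro γ n
    rw [MonoidAlgebra.coeff_mul_apply_left, MonoidAlgebra.coeff_mul_apply_left,
      Finsupp.sum_fintype _ _ (by simp), Finsupp.sum_fintype _ _ (by simp), Finset.smul_sum]
    symm
    refine Fintype.sum_equiv (conjHom hnorm γ).toEquiv _ _ fun m => ?_
    change _ = a.coeff (conjHom hnorm γ m) * b.coeff ((conjHom hnorm γ m)⁻¹ * conjHom hnorm γ n)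
    rw [← map_inv, ← map_mul, ha, hb, smul_mul']
  add_mem' {a b} ha hb := by
    rw [mem_fixedGroupAlgebra_iff hnorm] at ha hb ⊢
    intro γ n
    simp [ha, hb]
  algebraMap_mem' k := by
    classical
    rw [mem_fixedGroupAlgebra_iff hnorm]
    intro γ n
    simp only [MonoidAlgebra.coe_algebraMap, Function.comp_apply, MonoidAlgebra.coeff_single,
      Finsupp.single_apply]
    rw [← smul_algebraMap_eq (L := L) γ k]
    simp only [eq_comm (a := (1 : N)), map_eq_one_iff _ (conjHom hnorm γ).injective]
    split_ifs <;> simp [smul_algebraMap_eq (K := K) (L := L)]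

end FixedSubalgebra

theorem IsCosetSystem.nonempty_hopfGaloisStructure.{v} {K L Γ X : Type v} {M : Type*} [Field K]
    [Field M] [Field L] [Algebra K M] [Algebra K L] [Algebra M L] [IsScalarTower K M L] [Group Γ]
    [Finite Γ] [MulSemiringAction Γ L] [IsGaloisGroup Γ K L] [One X] [FiniteDimensional K M]
    {lam : Γ →* Equiv.Perm X} {rep : X → Γ} {N : Subgroup (Equiv.Perm X)}
    (hX : IsCosetSystem K M L lam rep)
    (hnorm : lam.range ≤ Subgroup.normalizer (N : Set (Equiv.Perm X)))
    (hN : IsRegularPermGroup N) : Nonempty (HopfGaloisStructure.{v} K M) := by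
  have := hX.finite
  obtain ⟨S, -⟩ := hX.exists_hopfGaloisStructure hnorm hN (fixedSubalgebra K L hnorm).val
    Subtype.val_injective Subtype.range_val
  exact ⟨S⟩

theorem Module.Basis.injective_of_linearIndependent {R V W ι : Type*} [Ring R] [AddCommGroup V]
    [Module R V] [AddCommGroup W] [Module R W] (b : Module.Basis ι R V) (f : V →ₗ[R] W)
    (h : LinearIndependent R (fun i => f (b i))) : Function.Injective f := by
  rw [injective_iff_map_eq_zero]
  intro v hv
  rw [← b.linearCombination_repr v, Finsupp.apply_linearCombination] at hv
  have := (linearIndependent_iff.1 h) _ hv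
  simpa using this

/-! ### Base change of Hopf Galois structures -/

namespace HopfGaloisStructure

/-- Both sides are additive in each of `b`, `x` and `y`, so additive generators suffice: for a base
change, pure tensors and products `αz`. -/
theorem act_mul_of_closure {R A B : Type*} [CommRing R] [CommRing A] [Algebra R A] [Ring B]
    [Bialgebra R B] (ρ : B →ₐ[R] Module.End R A) {s : Set B} {t : Set A}
    (hs : AddSubmonoid.closure s = ⊤) (ht : AddSubmonoid.closure t = ⊤)
    (h : ∀ b ∈ s, ∀ x ∈ t, ∀ y ∈ t, ρ b (x * y) =
      LinearMap.mul' R A (TensorProduct.map (ρ.toLinearMap.flip x) (ρ.toLinearMap.flip y)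
        (Coalgebra.comul (R := R) b))) (b : B) (x y : A) : ρ b (x * y) =
      LinearMap.mul' R A (TensorProduct.map (ρ.toLinearMap.flip x) (ρ.toLinearMap.flip y)
        (Coalgebra.comul (R := R) b)) := by
  have hb : b ∈ AddSubmonoid.closure s := hs ▸ AddSubmonoid.mem_top b
  have hx : x ∈ AddSubmonoid.closure t := ht ▸ AddSubmonoid.mem_top x
  have hy : y ∈ AddSubmonoid.closure t := ht ▸ AddSubmonoid.mem_top y
  induction hb using AddSubmonoid.closure_induction with
  | zero => simp
  | add b b' _ _ hb hb' => simp only [map_add, LinearMap.add_apply, hb, hb']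
  | mem b hb =>
    induction hx using AddSubmonoid.closure_induction with
    | zero => simp
    | add x x' _ _ hx hx' =>
      simp only [add_mul, map_add, TensorProduct.map_add_left, LinearMap.add_apply, hx, hx']
    | mem x hx =>
      induction hy using AddSubmonoid.closure_induction with
      | zero => simp
      | add y y' _ _ hy hy' =>
        simp only [mul_add, map_add, TensorProduct.map_add_right, LinearMap.add_apply, hy, hy']
      | mem y hy => exact h b hb x hx y hy

section BaseChange

variable {K E F L : Type*} [Field K] [Field E] [Field F] [Field L] [Algebra K E] [Algebra K F]
  [Algebra E L] [Algebra F L] [Algebra K L] [IsScalarTower K E L] [IsScalarTower K F L]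
  (S₂ : HopfGaloisStructure E L) (T : HopfGaloisStructure K F)
  (hgen : AddSubmonoid.closure
    {x : L | ∃ (α : E) (z : F), x = algebraMap E L α * algebraMap F L z} = ⊤)

theorem act_algebraMap_mul (s : S₂.H) (a : E) (x : L) :
    S₂.act s (algebraMap E L a * x) = algebraMap E L a * S₂.act s x := by
  rw [← Algebra.smul_def, map_smul, Algebra.smul_def]

include hgen in
theorem baseChange_act_mul (ρ : E ⊗[K] T.H →ₐ[E] Module.End E L)
    (hρ : ∀ a t α z, ρ (a ⊗ₜ t) (algebraMap E L α * algebraMap F L z) =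
      algebraMap E L a * algebraMap E L α * algebraMap F L (T.act t z))
    (b : E ⊗[K] T.H) (x y : L) : ρ b (x * y) =
      LinearMap.mul' E L (TensorProduct.map (ρ.toLinearMap.flip x) (ρ.toLinearMap.flip y)
        (Coalgebra.comul (R := E) b)) := by
  refine act_mul_of_closure ρ (s := {b | ∃ a t, b = a ⊗ₜ t}) ?_ hgen ?_ b x y
  · refine top_le_iff.1 fun b _ => ?_
    induction b with
    | zero => exact zero_mem _
    | add a b ha hb => exact add_mem (ha trivial) (hb trivial)
    | tmul a t => exact AddSubmonoid.subset_closure ⟨a, t, rfl⟩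
  rintro - ⟨a, t, rfl⟩ - ⟨α, z, rfl⟩ - ⟨β, w, rfl⟩
  have h1 : ∀ d : T.H ⊗[K] T.H,
      LinearMap.mul' E L (TensorProduct.map
        (ρ.toLinearMap.flip (algebraMap E L α * algebraMap F L z))
        (ρ.toLinearMap.flip (algebraMap E L β * algebraMap F L w))
        (TensorProduct.AlgebraTensorModule.tensorTensorTensorComm K E K E E E T.H T.H
          (((1 : E) ⊗ₜ a) ⊗ₜ d))) =
      algebraMap E L (a * α * β) * algebraMap F L (LinearMap.mul' K F
        (TensorProduct.map (T.act.toLinearMap.flip z) (T.act.toLinearMap.flip w) d)) := by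
    intro d
    induction d with
    | zero => simp
    | add a b ha hb => simp only [TensorProduct.tmul_add, map_add, ha, hb, mul_add]
    | tmul c d =>
      rw [TensorProduct.AlgebraTensorModule.tensorTensorTensorComm_tmul,
        TensorProduct.map_tmul, TensorProduct.map_tmul, LinearMap.mul'_apply,
        LinearMap.mul'_apply]
      simp only [LinearMap.flip_apply, AlgHom.toLinearMap_apply, hρ, map_one, map_mul]
      ring
  rw [TensorProduct.comul_tmul, CommSemiring.comul_apply, h1, ← T.act_mul, mul_mul_mul_comm,
    ← map_mul, ← map_mul (algebraMap F L), hρ]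
  simp only [map_mul (algebraMap E L), mul_assoc]

include hgen in
/-- A `K`-algebra homomorphism from the Hopf algebra of `T` to that of `S₂` that is compatible with
the actions identifies the latter with the base change of the former. -/
theorem exists_baseChange_equiv [FiniteDimensional E L] [FiniteDimensional K F]
    (hdim : Module.finrank E L = Module.finrank K F) (j : T.H →+* S₂.H)
    (hjK : ∀ k, j (algebraMap K T.H k) = algebraMap E S₂.H (algebraMap K E k))
    (hj : ∀ t z, S₂.act (j t) (algebraMap F L z) = algebraMap F L (T.act t z)) :
    ∃ e : (E ⊗[K] T.H) ≃ₐc[E] S₂.H, ∀ a h α z,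
      S₂.act (e (a ⊗ₜ[K] h)) (algebraMap E L α * algebraMap F L z) =
        algebraMap E L a * algebraMap E L α * algebraMap F L (T.act h z) := by
  let _ : Algebra K S₂.H := Algebra.compHom S₂.H (algebraMap K E)
  have : IsScalarTower K E S₂.H := IsScalarTower.of_algebraMap_eq' rfl
  let j' : T.H →ₐ[K] S₂.H := { j with commutes' := hjK }
  let e : E ⊗[K] T.H →ₐ[E] S₂.H := Algebra.TensorProduct.lift (Algebra.ofId E S₂.H) j'
    fun a t => Algebra.commutes _ _
  have he : ∀ a t, e (a ⊗ₜ t) = a • j t := fun a t => by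
    refine (Algebra.TensorProduct.lift_tmul _ _ _ a t).trans ?_
    rw [Algebra.ofId_apply, Algebra.smul_def]
    rfl
  have heact : ∀ a t α z, S₂.act (e (a ⊗ₜ t)) (algebraMap E L α * algebraMap F L z) =
      algebraMap E L a * algebraMap E L α * algebraMap F L (T.act t z) := fun a t α z => by
    rw [he, act_algebraMap_mul, map_smul, LinearMap.smul_apply, hj, Algebra.smul_def]
    ring
  have hone : ∀ b, S₂.act (e b) 1 = algebraMap E L (Coalgebra.counit b) := by
    intro b
    induction b with
    | zero => simp
    | add a b ha hb => simp only [map_add, LinearMap.add_apply, ha, hb]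
    | tmul a t =>
      have h1 := hj t 1
      rw [map_one, T.act_one] at h1
      rw [he, map_smul, LinearMap.smul_apply, h1, TensorProduct.counit_tmul, Algebra.smul_def,
        ← IsScalarTower.algebraMap_apply, Algebra.smul_def, map_mul,
        ← IsScalarTower.algebraMap_apply, mul_comm]
      rfl
  have hmul := baseChange_act_mul T hgen (S₂.act.comp e) heact
  obtain ⟨e', he'⟩ := S₂.exists_bialgHom e hone fun b x y =>
    (hmul b x y).trans (mul'_map_flip_eq_tensorEval _ x y _)
  have hinj : Function.Injective e := by
    let b := Module.Basis.ofVectorSpace K T.H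
    refine (b.baseChange E).injective_of_linearIndependent e.toLinearMap ?_
    let f : T.H →ₗ[K] F → L :=
      ((IsScalarTower.toAlgHom K F L).toLinearMap.compLeft F) ∘ₗ repFun T.act
    have hf : IsBaseInjective f := T.isBaseInjective_repFun.extend fun _ _ => rfl
    -- Injectivity is tested on `F` alone: the actions of a `K`-basis of `T.H`, as functions `F →
    -- L`, are independent over `L`, hence over `E`.
    have h1 : LinearIndependent E fun i => f (b i) :=
      ((isBaseInjective_iff_linearIndependent b).1 hf).restrict_scalars fun x y hxy => by
        simpa [Algebra.smul_def] using hxy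
    let g : S₂.H →ₗ[E] F → L :=
      { toFun := fun s z => S₂.act s (algebraMap F L z)
        map_add' := fun s t => by ext; simp
        map_smul' := fun c s => by ext; simp }
    refine LinearIndependent.of_comp g ?_
    convert! h1 using 1
    ext i z
    simp [g, he, hj, f]
  have hinj' : Function.Injective e' := fun a b hab => hinj (by rw [← he', ← he', hab])
  have hbij : Function.Bijective e' := by
    refine ⟨hinj', (LinearMap.injective_iff_surjective_of_finrank_eq_finrank
      (f := (e' : E ⊗[K] T.H →ₗ[E] S₂.H)) ?_).1 hinj'⟩
    rw [Module.finrank_baseChange, T.finrank_eq, S₂.finrank_eq, hdim]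
  refine ⟨BialgEquiv.ofBijective e' hbij, fun a t α z => ?_⟩
  rw [← heact, ← he']
  rfl

end BaseChange

variable {K L : Type*} [Field K] [Field L] [Algebra K L] [FiniteDimensional K L]
  {E F : IntermediateField K L} (hEF : Function.Bijective (mulTensor E F))
  (S₂ : HopfGaloisStructure E L) (T : HopfGaloisStructure K F)

include hEF in
/-- A `K`-algebra homomorphism from the Hopf algebra of `T` to that of `S₂` that is compatible with
the actions exhibits `S₂` as the base change of `T`. -/
theorem isBaseChange_of_hom (hdim : Module.finrank E L = Module.finrank K F)
    (j : T.H →+* S₂.H)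
    (hjK : ∀ k, j (algebraMap K T.H k) = algebraMap E S₂.H (algebraMap K E k))
    (hj : ∀ t (z : F), S₂.act (j t) (z : L) = T.act t z) : T.IsBaseChange S₂ := by
  refine exists_baseChange_equiv S₂ T ?_ hdim j hjK hj
  refine top_le_iff.1 fun x _ => ?_
  induction x using induction_mulTensor hEF.2 with
  | zero => exact zero_mem _
  | add a b ha hb => exact add_mem (ha trivial) (hb trivial)
  | mul α z => exact AddSubmonoid.subset_closure ⟨α, z, rfl⟩

variable {S₂ T}

include hEF in
-- The element of `E ⊗ T.H` that corresponds to `1 ⊗ t'` acts on `F` as `t'` does, so it sends `z`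
-- to `1 ⊗ (t' · z)` in `E ⊗ F`. A `K`-linear retraction of `E` onto `K` turns it into an element of
-- `T.H` with the same action.
theorem IsBaseChange.isIso {T' : HopfGaloisStructure K F} (hT : T.IsBaseChange S₂)
    (hT' : T'.IsBaseChange S₂) : T'.IsIso T := by
  obtain ⟨e, he⟩ := hT
  obtain ⟨e', he'⟩ := hT'
  obtain ⟨p, hp⟩ := LinearMap.exists_leftInverse_of_injective (Algebra.linearMap K E)
    (LinearMap.ker_eq_bot.2 (algebraMap K E).injective)
  have hp1 : p 1 = 1 := by simpa using DFunLike.congr_fun hp 1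
  refine isIso_of_forall_exists T' T fun t' => ?_
  refine ⟨TensorProduct.lid K T.H (p.rTensor T.H (e.symm (e' (1 ⊗ₜ t')))), fun z => ?_⟩
  have h1 : ∀ u : E ⊗[K] T.H, mulTensor E F ((T.act.toLinearMap.flip z).lTensor E u) =
      S₂.act (e u) z := by
    intro u
    induction u with
    | zero => simp
    | add a b ha hb => simp only [map_add, LinearMap.add_apply, ha, hb]
    | tmul a t =>
      have := he a t 1 z
      rw [OneMemClass.coe_one, one_mul, mul_one] at this
      rw [this]
      simp
  have h2 : ∀ u : E ⊗[K] T.H, T.act (TensorProduct.lid K T.H (p.rTensor T.H u)) z =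
      TensorProduct.lid K F (p.rTensor F ((T.act.toLinearMap.flip z).lTensor E u)) := by
    intro u
    induction u with
    | zero => simp
    | add a b ha hb => simp only [map_add, LinearMap.add_apply, ha, hb]
    | tmul a t => simp
  have h3 : (T.act.toLinearMap.flip z).lTensor E (e.symm (e' (1 ⊗ₜ t'))) =
      1 ⊗ₜ T'.act t' z := by
    apply hEF.1
    rw [h1, BialgEquiv.apply_symm_apply, mulTensor_tmul]
    have := he' 1 t' 1 z
    rwa [OneMemClass.coe_one, one_mul, one_mul] at this
  rw [h2, h3]
  simp [hp1]

end HopfGaloisStructure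

/-! ### Permutations of `G = J ⋊ G'` -/

section Complement

variable {G : Type*} [Group G] {J G' : Subgroup G} (hc : J.IsComplement' G')

/-- The projection of `G = J ⋊ G'` onto `G'`. -/
def complProj [J.Normal] : G →* G' :=
  hc.symm.QuotientMulEquiv.toMonoidHom.comp (QuotientGroup.mk' J)

theorem complProj_inv_mul_mem [J.Normal] (g : G) : (complProj hc g : G)⁻¹ * g ∈ J :=
  hc.symm.inv_toLeftFun_mul_mem g

theorem complProj_of_mem [J.Normal] {g : G} (hg : g ∈ J) : complProj hc g = 1 := by
  have h1 := complProj_inv_mul_mem hc g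
  rw [J.mul_mem_cancel_right hg, inv_mem_iff] at h1
  exact Subtype.ext (Subgroup.disjoint_def.1 hc.disjoint h1 (complProj hc g).2)

@[simp] theorem complProj_coe [J.Normal] (τ : G') : complProj hc (τ : G) = τ := by
  have h1 := complProj_inv_mul_mem hc (τ : G)
  have h2 := Subgroup.disjoint_def.1 hc.disjoint h1
    (mul_mem (inv_mem (complProj hc (τ : G)).2) τ.2)
  exact Subtype.ext (inv_mul_eq_one.1 h2)

theorem cosetAction_inv_mul_mem (g : G) (σ : J) : (cosetAction hc g σ : G)⁻¹ * (g * σ) ∈ G' :=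
  hc.inv_toLeftFun_mul_mem (g * σ)

/-- The left side is the factorization of `gσ` in `J · G'`: modulo the normal subgroup `J`, both
`gσ` and `g` have the same component in `G'`. -/
theorem cosetAction_mul_complProj [J.Normal] (g : G) (σ : J) :
    (cosetAction hc g σ : G) * complProj hc g = g * σ := by
  have h1 : complProj hc ((cosetAction hc g σ : G)⁻¹ * (g * σ)) = complProj hc g := by
    rw [map_mul, map_mul, complProj_of_mem hc (inv_mem (cosetAction hc g σ).2),
      complProj_of_mem hc σ.2, one_mul, mul_one]
  rw [← h1, complProj_coe hc ⟨_, cosetAction_inv_mul_mem hc g σ⟩, mul_inv_cancel_left]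

theorem permProd_apply (p : Equiv.Perm J × Equiv.Perm G') (σ : J) (τ : G') :
    permProd hc p (σ * τ) = p.1 σ * p.2 τ := by
  have h1 : (Equiv.ofBijective _ hc).symm ((σ : G) * τ) = (σ, τ) :=
    (Equiv.ofBijective _ hc).symm_apply_eq.2 rfl
  change Equiv.ofBijective _ hc (Equiv.prodCongr p.1 p.2 ((Equiv.ofBijective _ hc).symm _)) = _
  rw [h1]
  rfl

include hc in
theorem exists_eq_mul (g : G) : ∃ (σ : J) (τ : G'), g = σ * τ :=
  let ⟨⟨σ, τ⟩, h⟩ := hc.2 g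
  ⟨σ, τ, h.symm⟩

/-- Left translation by `g` is itself a product permutation, so it normalizes `ι(N₁ × N₂)` as soon
as its two components normalize `N₁` and `N₂`. -/
theorem permProd_cosetAction [J.Normal] (g : G) :
    permProd hc (cosetAction hc g, MulAction.toPermHom G' G' (complProj hc g)) =
      MulAction.toPermHom G G g := by
  ext x
  obtain ⟨σ, τ, rfl⟩ := exists_eq_mul hc x
  rw [permProd_apply]
  change (cosetAction hc g σ : G) * (complProj hc g * τ) = g * (σ * τ)
  rw [← mul_assoc, cosetAction_mul_complProj, mul_assoc]

theorem isRegularPermGroup_map_permProd {N₁ : Subgroup (Equiv.Perm J)}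
    {N₂ : Subgroup (Equiv.Perm G')} (h₁ : IsRegularPermGroup N₁) (h₂ : IsRegularPermGroup N₂) :
    IsRegularPermGroup ((N₁.prod N₂).map (permProd hc)) := by
  intro x y
  obtain ⟨σ, τ, rfl⟩ := exists_eq_mul hc x
  obtain ⟨σ', τ', rfl⟩ := exists_eq_mul hc y
  obtain ⟨n₁, hn₁, hu₁⟩ := h₁ σ σ'
  obtain ⟨n₂, hn₂, hu₂⟩ := h₂ τ τ'
  refine ⟨⟨permProd hc (n₁, n₂), _, ⟨n₁.2, n₂.2⟩, rfl⟩, ?_, ?_⟩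
  · change permProd hc (n₁, n₂) _ = _
    rw [permProd_apply, hn₁, hn₂]
  · rintro ⟨_, ⟨m₁, m₂⟩, ⟨hm₁, hm₂⟩, rfl⟩ hm
    change permProd hc (m₁, m₂) _ = _ at hm
    rw [permProd_apply] at hm
    have h3 := hc.1 (a₁ := (m₁ σ, m₂ τ)) (a₂ := (σ', τ')) hm
    have h4 := hu₁ ⟨m₁, hm₁⟩ (congrArg Prod.fst h3)
    have h5 := hu₂ ⟨m₂, hm₂⟩ (congrArg Prod.snd h3)
    subst h4 h5
    rfl

theorem normalizes_map_permProd [J.Normal] {N₁ : Subgroup (Equiv.Perm J)}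
    {N₂ : Subgroup (Equiv.Perm G')}
    (h₁ : (cosetAction hc).range ≤ Subgroup.normalizer (N₁ : Set (Equiv.Perm J)))
    (h₂ : (MulAction.toPermHom G' G').range ≤ Subgroup.normalizer (N₂ : Set (Equiv.Perm G'))) :
    (MulAction.toPermHom G G).range ≤
      Subgroup.normalizer ((N₁.prod N₂).map (permProd hc) : Set (Equiv.Perm G)) := by
  refine le_trans ?_ (Subgroup.le_normalizer_map (permProd hc))
  rintro _ ⟨g, rfl⟩
  refine ⟨_, ?_, permProd_cosetAction hc g⟩
  have h3 := Subgroup.mem_normalizer_iff.1 (h₁ ⟨g, rfl⟩)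
  have h4 := Subgroup.mem_normalizer_iff.1 (h₂ ⟨complProj hc g, rfl⟩)
  exact Subgroup.mem_normalizer_iff.2 fun p => and_congr (h3 p.1) (h4 p.2)

theorem isRegularPermGroup_map_cosetAction [J.Normal] :
    IsRegularPermGroup (J.map (cosetAction hc)) := by
  have key : ∀ σ ρ : J, cosetAction hc (σ : G) ρ = σ * ρ := fun σ ρ => by
    have := cosetAction_mul_complProj hc (σ : G) ρ
    rw [complProj_of_mem hc σ.2, OneMemClass.coe_one, mul_one] at this
    exact Subtype.ext this
  intro x y
  refine ⟨⟨cosetAction hc (y * x⁻¹ : J), _, (y * x⁻¹).2, rfl⟩, ?_, ?_⟩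
  · change cosetAction hc _ x = y
    rw [key, inv_mul_cancel_right]
  · rintro ⟨_, σ, hσ, rfl⟩ h
    change cosetAction hc σ x = y at h
    rw [key ⟨σ, hσ⟩] at h
    subst h
    rw [mul_inv_cancel_right]

end Complement

theorem isRegularPermGroup_range_toPermHom (G : Type*) [Group G] :
    IsRegularPermGroup (MulAction.toPermHom G G).range := by
  intro x y
  refine ⟨⟨_, y * x⁻¹, rfl⟩, inv_mul_cancel_right y x, ?_⟩
  rintro ⟨_, g, rfl⟩ h
  change g * x = y at h
  subst h
  rw [mul_inv_cancel_right]


/-! ### The fields `E` and `F` -/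

section Galois

variable {K L : Type*} [Field K] [Field L] [Algebra K L]

theorem IsCosetSystem.regular (K L : Type*) [Field K] [Field L] [Algebra K L] (Γ : Type*) [Group Γ]
    [MulSemiringAction Γ L] [hG : IsGaloisGroup Γ K L] :
    IsCosetSystem K L L (MulAction.toPermHom Γ Γ) fun γ : Γ => γ where
  rep_lam γ x m := mul_smul γ x _
  rep_one m := one_smul Γ _
  ext x y h := by
    have := hG.faithful
    exact eq_of_smul_eq_smul (α := L) h
  card := hG.card_eq_finrank
  fixed l _ := ⟨l, rfl⟩

variable [FiniteDimensional K L] [IsGalois K L] {J G' : Subgroup Gal(L/K)}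
  (hc : J.IsComplement' G') {E F : IntermediateField K L}
  (hE : E = IntermediateField.fixedField G') (hF : F = IntermediateField.fixedField J)

include hE in
theorem isGaloisGroup_of_eq_fixedField : IsGaloisGroup G' E L :=
  IsGaloisGroup.of_fixedPoints_eq Gal(L/K) K L G' E hE.symm

include hE in
theorem smul_eq_of_eq_fixedField {g : Gal(L/K)} (hg : g ∈ G') (x : E) : g • (x : L) = x := by
  subst hE
  exact (IntermediateField.mem_fixedField_iff G' _).1 x.2 g hg

include hE in
theorem mem_of_smul_eq {g : Gal(L/K)} (h : ∀ x : E, g • (x : L) = x) : g ∈ G' := by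
  rw [← IntermediateField.fixingSubgroup_fixedField G', ← hE,
    IntermediateField.mem_fixingSubgroup_iff]
  exact fun x hx => h ⟨x, hx⟩

include hE in
theorem mem_of_forall_smul_eq {x : L} (h : ∀ g ∈ G', g • x = x) : x ∈ E := by
  rw [hE, IntermediateField.mem_fixedField_iff]
  exact h

include hc hE in
theorem finrank_eq_card_complement : Module.finrank K E = Nat.card J := by
  have h1 := Module.finrank_mul_finrank K E L
  have h2 : Module.finrank E L = Nat.card G' := by
    rw [hE, IntermediateField.finrank_fixedField_eq_card]
  rw [h2, ← IsGaloisGroup.card_eq_finrank Gal(L/K) K L, ← hc.card_mul_card] at h1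
  exact Nat.eq_of_mul_eq_mul_right Nat.card_pos h1

include hE in
-- The element `γσ` differs from its representative in `J` by an element of `G'` on the right, which
-- fixes `E`.
theorem IsCosetSystem.left [J.Normal] :
    IsCosetSystem K E L (cosetAction hc) fun σ : J => (σ : Gal(L/K)) where
  rep_lam γ σ x := by
    rw [← mul_smul, ← cosetAction_mul_complProj, mul_smul]
    congr 1
    exact (smul_eq_of_eq_fixedField hE (complProj hc γ).2 x).symm
  rep_one x := one_smul _ _
  ext σ σ' h := by
    refine Subtype.ext (inv_mul_eq_one.1 (Subgroup.disjoint_def.1 hc.disjoint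
      (mul_mem (inv_mem σ.2) σ'.2) (mem_of_smul_eq hE fun x => ?_)))
    rw [mul_smul, inv_smul_eq_iff]
    exact (h x).symm
  card := (finrank_eq_card_complement hc hE).symm
  fixed l h := by
    refine ⟨⟨l, mem_of_forall_smul_eq hE fun g hg => h g ?_⟩, rfl⟩
    have h1 := cosetAction_mul_complProj hc g 1
    rw [complProj_coe hc ⟨g, hg⟩, OneMemClass.coe_one, mul_one] at h1
    exact Subtype.ext (mul_eq_right.1 h1)

include hF in
-- Since `J` is normal, `γτ` and `complProj hc γ * τ` differ by an element of `J` on the right,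
-- which fixes `F`.
theorem IsCosetSystem.right [J.Normal] :
    IsCosetSystem K F L ((MulAction.toPermHom G' G').comp (complProj hc))
      fun τ : G' => (τ : Gal(L/K)) where
  rep_lam γ τ x := by
    have h1 : (τ : Gal(L/K))⁻¹ * ((complProj hc γ : Gal(L/K))⁻¹ * γ) * τ ∈ J := by
      have := ‹J.Normal›.conj_mem _ (complProj_inv_mul_mem hc γ) (τ : Gal(L/K))⁻¹
      rwa [inv_inv] at this
    have h2 := smul_eq_of_eq_fixedField hF h1 x
    rw [mul_smul, mul_smul, mul_smul, inv_smul_eq_iff, inv_smul_eq_iff] at h2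
    exact (mul_smul _ _ _).trans h2.symm
  rep_one x := one_smul _ _
  ext σ σ' h := by
    refine Subtype.ext (inv_mul_eq_one.1 (Subgroup.disjoint_def.1 hc.symm.disjoint
      (mul_mem (inv_mem σ.2) σ'.2) (mem_of_smul_eq hF fun x => ?_)))
    rw [mul_smul, inv_smul_eq_iff]
    exact (h x).symm
  card := (finrank_eq_card_complement hc.symm hF).symm
  fixed l h := by
    refine ⟨⟨l, mem_of_forall_smul_eq hF fun g hg => h g ?_⟩, rfl⟩
    rw [MonoidHom.comp_apply, complProj_of_mem hc hg]
    exact one_smul G' 1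

include hc hE hF in
theorem sup_eq_top_of_isComplement' : E ⊔ F = ⊤ := by
  have h1 : (E ⊔ F).fixingSubgroup = ⊥ := by
    rw [IntermediateField.fixingSubgroup_sup, hE, hF, IntermediateField.fixingSubgroup_fixedField,
      IntermediateField.fixingSubgroup_fixedField, hc.symm.disjoint.eq_bot]
  rw [← IsGalois.fixedField_fixingSubgroup (E ⊔ F), h1, IntermediateField.fixedField_bot]

include hc hE hF in
theorem inf_eq_bot_of_isComplement' : E ⊓ F = ⊥ := by
  refine eq_bot_iff.2 fun x ⟨hxE, hxF⟩ => (IsGalois.mem_bot_iff_fixed x).2 fun g => ?_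
  obtain ⟨σ, τ, rfl⟩ := exists_eq_mul hc g
  have h1 := smul_eq_of_eq_fixedField hE τ.2 ⟨x, hxE⟩
  have h2 := smul_eq_of_eq_fixedField hF σ.2 ⟨x, hxF⟩
  change ((σ : Gal(L/K)) * τ) • x = x
  rw [mul_smul, h1, h2]

include hc hE hF in
theorem finrank_mul_finrank_of_isComplement' :
    Module.finrank K E * Module.finrank K F = Module.finrank K L := by
  rw [finrank_eq_card_complement hc hE, finrank_eq_card_complement hc.symm hF, hc.card_mul_card,
    IsGaloisGroup.card_eq_finrank Gal(L/K) K L]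

include hc hE hF in
theorem finrank_eq_finrank_of_isComplement' : Module.finrank E L = Module.finrank K F := by
  rw [finrank_eq_card_complement hc.symm hF, hE, IntermediateField.finrank_fixedField_eq_card]

include hc hE hF in
theorem linearDisjoint_of_isComplement' : E.LinearDisjoint F := by
  apply IntermediateField.LinearDisjoint.of_finrank_sup
  rw [sup_eq_top_of_isComplement' hc hE hF, IntermediateField.finrank_top',
    finrank_mul_finrank_of_isComplement' hc hE hF]

include hc hE hF in
theorem mulTensor_bijective_of_isComplement' : Function.Bijective (mulTensor E F) := by
  have h1 : Function.Surjective (mulTensor E F) := by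
    rw [← AlgHom.range_eq_top, mulTensor, Algebra.TensorProduct.productMap_range,
      IntermediateField.range_val, IntermediateField.range_val,
      ← IntermediateField.sup_toSubalgebra_of_left, sup_eq_top_of_isComplement' hc hE hF,
      IntermediateField.top_toSubalgebra]
  refine ⟨(LinearMap.injective_iff_surjective_of_finrank_eq_finrank
    (f := (mulTensor E F).toLinearMap) ?_).2 h1, h1⟩
  rw [Module.finrank_tensorProduct, finrank_mul_finrank_of_isComplement' hc hE hF]

end Galois

/-- The groups used are the left translations by `J` on `J`, normalized because `J` is normal in
`G`, and the left translations of `G'`, which contain the image of `G`. -/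
theorem isHopfGalois_of_isComplement'.{v} {K L : Type v} [Field K] [Field L] [Algebra K L]
    [FiniteDimensional K L] [IsGalois K L] {J G' : Subgroup Gal(L/K)} [J.Normal]
    (hc : J.IsComplement' G') {E F : IntermediateField K L}
    (hE : E = IntermediateField.fixedField G') (hF : F = IntermediateField.fixedField J) :
    IsHopfGalois K E ∧ IsHopfGalois K F := by
  constructor
  · refine (IsCosetSystem.left hc hE).nonempty_hopfGaloisStructure ?_
      (isRegularPermGroup_map_cosetAction hc)
    rw [MonoidHom.range_eq_map, ← Subgroup.normalizer_eq_top (H := J)]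
    exact Subgroup.le_normalizer_map _
  · refine (IsCosetSystem.right hc hF).nonempty_hopfGaloisStructure ?_
      (isRegularPermGroup_range_toPermHom G')
    rintro _ ⟨g, rfl⟩
    exact Subgroup.le_normalizer ⟨complProj hc g, rfl⟩

section Action

variable {K L : Type*} [Field K] [Field L] [Algebra K L] [FiniteDimensional K L] [IsGalois K L]
  {J G' : Subgroup Gal(L/K)} [J.Normal] {E F : IntermediateField K L}
  (hE : E = IntermediateField.fixedField G') (hF : F = IntermediateField.fixedField J)

include hE hF in
-- Here `τ` fixes `α`, and `σ` fixes `τ z`, because `τ⁻¹στ` is in `J` and fixes `z`. This identity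
-- matches the Kronecker product with `ι`.
theorem mul_smul_coe_mul_coe (σ : J) (τ : G') (α : E) (z : F) :
    ((σ : Gal(L/K)) * τ) • ((α : L) * z) = (σ : Gal(L/K)) • (α : L) * (τ : Gal(L/K)) • (z : L) := by
  have h1 : (τ : Gal(L/K))⁻¹ * σ * τ ∈ J := by
    have := ‹J.Normal›.conj_mem _ σ.2 (τ : Gal(L/K))⁻¹
    rwa [inv_inv] at this
  have h2 := smul_eq_of_eq_fixedField hF h1 z
  rw [mul_smul, mul_smul, inv_smul_eq_iff] at h2
  rw [smul_mul', mul_smul, mul_smul, h2, smul_eq_of_eq_fixedField hE τ.2]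

end Action

/-! ### The induced structure as a tensor product -/

namespace HopfGaloisStructure

section Correspondence

variable {K L : Type*} [Field K] [Field L] [Algebra K L] [FiniteDimensional K L] [IsGalois K L]
  {J G' : Subgroup Gal(L/K)} [J.Normal] (hc : J.IsComplement' G') {E F : IntermediateField K L}
  (hE : E = IntermediateField.fixedField G') (hF : F = IntermediateField.fixedField J)
  (hEF : Function.Bijective (mulTensor E F))
  {S₁ : HopfGaloisStructure K E} {S₂ : HopfGaloisStructure E L} {T : HopfGaloisStructure K F}

include hE in
-- This is `L ⊗[E] (E ⊗[K] T.H) = L ⊗[K] T.H`; evaluation is compatible with it because `τ` fixes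
-- the scalars from `E`.
theorem IsBaseChange.exists_evalAt_eq [IsGaloisGroup G' E L] (hT : T.IsBaseChange S₂)
    (a : L ⊗[E] S₂.H) : ∃ b : L ⊗[K] T.H, ∀ (τ : G') (z : F),
      T.evalAt (τ : Gal(L/K)) b z = S₂.evalAt τ a z := by
  obtain ⟨e, he⟩ := hT
  induction a with
  | zero => exact ⟨0, by simp⟩
  | add a a' ha ha' =>
    obtain ⟨b, hb⟩ := ha
    obtain ⟨b', hb'⟩ := ha'
    exact ⟨b + b', fun τ z => by simp only [map_add, Pi.add_apply, hb, hb']⟩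
  | tmul l s =>
    obtain ⟨u, rfl⟩ : ∃ u, e u = s := e.surjective s
    induction u with
    | zero => exact ⟨0, by simp⟩
    | add a a' ha ha' =>
      obtain ⟨b, hb⟩ := ha
      obtain ⟨b', hb'⟩ := ha'
      exact ⟨b + b', fun τ z => by
        simp only [map_add, Pi.add_apply, hb, hb', TensorProduct.tmul_add]⟩
    | tmul a t =>
      refine ⟨(l * a) ⊗ₜ t, fun τ z => ?_⟩
      have h1 := he a t 1 z
      rw [OneMemClass.coe_one, one_mul, mul_one] at h1
      rw [evalAt_tmul, evalAt_tmul, h1]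
      change l * a * (τ : Gal(L/K)) • (T.act t z : L) = l * (τ : Gal(L/K)) • ((a : L) * T.act t z)
      rw [smul_mul', smul_eq_of_eq_fixedField hE τ.2, mul_assoc]

include hE hF in
theorem exists_evalAt_tensorProduct_eq (a : L ⊗[K] S₁.H) (b : L ⊗[K] T.H) :
    ∃ c : L ⊗[K] (tensorProduct hEF S₁ T).H, ∀ (σ : J) (τ : G') (α : E) (z : F),
      (tensorProduct hEF S₁ T).evalAt ((σ : Gal(L/K)) * τ) c ((α : L) * z) =
        S₁.evalAt (σ : Gal(L/K)) a α * T.evalAt (τ : Gal(L/K)) b z := by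
  induction a with
  | zero => exact ⟨0, by simp⟩
  | add a a' ha ha' =>
    obtain ⟨c, hc⟩ := ha
    obtain ⟨c', hc'⟩ := ha'
    exact ⟨c + c', fun σ τ α z => by simp only [map_add, Pi.add_apply, hc, hc', add_mul]⟩
  | tmul l s =>
    induction b with
    | zero => exact ⟨0, by simp⟩
    | add b b' hb hb' =>
      obtain ⟨c, hc⟩ := hb
      obtain ⟨c', hc'⟩ := hb'
      exact ⟨c + c', fun σ τ α z => by simp only [map_add, Pi.add_apply, hc, hc', mul_add]⟩
    | tmul l' t =>
      refine ⟨(l * l') ⊗ₜ (s ⊗ₜ[K] t : S₁.H ⊗[K] T.H), fun σ τ α z => ?_⟩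
      rw [evalAt_tmul, evalAt_tmul]
      refine ((tensorProduct hEF S₁ T).evalAt_tmul _ _ _ _).trans ?_
      change l * l' * ((σ : Gal(L/K)) * τ) • (kroneckerAct hEF S₁ T (s ⊗ₜ t) ((α : L) * z)) =
        l * (σ : Gal(L/K)) • (S₁.act s α : L) * (l' * (τ : Gal(L/K)) • (T.act t z : L))
      rw [kroneckerAct_tmul, mul_smul_coe_mul_coe hE hF]
      ring

include hE hF in
-- A representative of `φ` in `L ⊗ S₁.H` and one of `ψ`, transferred from `S₂` to `T`, combine to an
-- element that represents `ι(φ, ψ)`.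
theorem tensorProduct_correspondsTo [IsGaloisGroup G' E L] {N₁ : Subgroup (Equiv.Perm J)}
    {N₂ : Subgroup (Equiv.Perm G')}
    (h₁ : S₁.CorrespondsTo (L := L) (cosetAction hc) (fun σ : J => (σ : Gal(L/K))) N₁)
    (h₂ : S₂.CorrespondsTo (L := L) (MulAction.toPermHom G' G') (fun τ : G' => τ) N₂)
    (hT : T.IsBaseChange S₂) :
    (tensorProduct hEF S₁ T).CorrespondsTo (L := L) (MulAction.toPermHom Gal(L/K) Gal(L/K))
      (fun g : Gal(L/K) => g) ((N₁.prod N₂).map (permProd hc)) := by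
  refine correspondsTo_of_represents (IsCosetSystem.regular K L Gal(L/K))
    (isRegularPermGroup_map_permProd hc h₁.regular h₂.regular)
    (normalizes_map_permProd hc h₁.normalized h₂.normalized) ?_
  rintro ⟨_, ⟨φ, ψ⟩, ⟨hφ, hψ⟩, rfl⟩
  obtain ⟨Φ₁, -, -, hr₁⟩ := h₁.exists_represents (IsCosetSystem.left hc hE)
  obtain ⟨Φ₂, -, -, hr₂⟩ := h₂.exists_represents (IsCosetSystem.regular E L G')
  obtain ⟨b, hb⟩ := hT.exists_evalAt_eq hE (Φ₂.symm (MonoidAlgebra.single ⟨ψ, hψ⟩ 1))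
  obtain ⟨c, hc'⟩ := exists_evalAt_tensorProduct_eq hE hF hEF
    (Φ₁.symm (MonoidAlgebra.single ⟨φ, hφ⟩ 1)) b
  refine ⟨c, fun x m => ?_⟩
  obtain ⟨σ, τ, rfl⟩ := exists_eq_mul hc x
  induction m using induction_mulTensor hEF.2 with
  | zero =>
    have := evalAt_smul (tensorProduct hEF S₁ T) ((σ : Gal(L/K)) * τ) c 0 0
    rw [zero_smul, zero_smul] at this
    rw [this, map_zero, smul_zero]
  | add x y hx hy => rw [evalAt_add, hx, hy, map_add, smul_add]
  | mul α z =>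
    have h3 : (permProd hc (φ, ψ))⁻¹ ((σ : Gal(L/K)) * τ) = (φ⁻¹ σ : J) * (ψ⁻¹ τ : G') := by
      rw [← map_inv, permProd_apply]
      rfl
    have h4 := hr₁ ⟨φ, hφ⟩ σ α
    have h5 := hr₂ ⟨ψ, hψ⟩ τ z
    change _ = (permProd hc (φ, ψ))⁻¹ ((σ : Gal(L/K)) * τ) • ((α : L) * z)
    rw [hc', hb, h4, h5, h3, mul_smul_coe_mul_coe hE hF]
    rfl

end Correspondence

/-- The permutation group of `S₂` is kept, and `G` acts on `G'` through its quotient by `J`. Fixed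
elements for all of `G` are in particular fixed by `G'`, so the new Hopf algebra sits inside that of
`S₂`. -/
theorem exists_isBaseChange.{v, v'} {K L : Type v} [Field K] [Field L] [Algebra K L]
    [FiniteDimensional K L] [IsGalois K L] {J G' : Subgroup Gal(L/K)} [J.Normal]
    (hc : J.IsComplement' G') {E F : IntermediateField K L}
    (hE : E = IntermediateField.fixedField G') (hF : F = IntermediateField.fixedField J)
    [IsGaloisGroup G' E L]
    (S₂ : HopfGaloisStructure.{v'} E L) :
    ∃ T : HopfGaloisStructure.{v'} K F, T.IsBaseChange S₂ := by
  have hX := IsCosetSystem.right hc hF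
  obtain ⟨N, hS⟩ := S₂.exists_correspondsTo (IsCosetSystem.regular E L G')
  have hnorm : ((MulAction.toPermHom G' G').comp (complProj hc)).range ≤
      Subgroup.normalizer (N : Set (Equiv.Perm G')) := by
    rintro _ ⟨g, rfl⟩
    exact hS.normalized ⟨complProj hc g, rfl⟩
  obtain ⟨Φ, hΦ, hact⟩ := hS.exists_equiv
  let _ : Algebra K S₂.H := Algebra.compHom S₂.H (algebraMap K E)
  have : IsScalarTower K E S₂.H := IsScalarTower.of_algebraMap_eq' rfl
  let f : S₂.H →ₐ[K] MonoidAlgebra L N :=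
    { (Φ : L ⊗[E] S₂.H →+* MonoidAlgebra L N).comp
        (Algebra.TensorProduct.includeRight : S₂.H →ₐ[E] L ⊗[E] S₂.H).toRingHom with
      commutes' := fun k => by
        change Φ (1 ⊗ₜ[E] algebraMap E S₂.H (algebraMap K E k)) = _
        rw [Algebra.algebraMap_eq_smul_one (algebraMap K E k), ← TensorProduct.smul_tmul,
          Algebra.smul_def, mul_one]
        change (Φ : L ⊗[E] S₂.H ≃ₐ[L] MonoidAlgebra L N) (algebraMap L _ (algebraMap K L k)) = _
        rw [AlgEquiv.commutes]
        rfl }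
  have hf : ∀ s, f s = Φ (1 ⊗ₜ s) := fun _ => rfl
  -- This is `L[N]^G`, cut out inside `S₂.H` so that the new structure lives in the same universe as
  -- `S₂`.
  let A := (fixedSubalgebra K L hnorm).comap f
  have hfinj : Function.Injective f := by
    intro s t hst
    rw [hf, hf] at hst
    exact Algebra.TensorProduct.includeRight_injective (algebraMap E L).injective (Φ.injective hst)
  have hrange : Set.range (f.comp A.val) = fixedGroupAlgebra L
      ((MulAction.toPermHom G' G').comp (complProj hc)) N := by
    ext x
    constructor
    · rintro ⟨s, rfl⟩
      exact s.2
    · intro hx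
      -- An element of `G'` is its own projection, so invariance under `G` contains invariance under
      -- `G'`, and `x` comes from `S₂.H`.
      have hx' : x ∈ fixedGroupAlgebra L (MulAction.toPermHom G' G') N := fun τ n n' hn => by
        refine hx τ n n' ?_
        rw [hn, MonoidHom.comp_apply, complProj_coe]
      rw [← hΦ] at hx'
      obtain ⟨s, rfl⟩ := hx'
      exact ⟨⟨s, hx⟩, rfl⟩
  have := hX.finite
  obtain ⟨T, e, he⟩ := hX.exists_hopfGaloisStructure hnorm hS.regular (f.comp A.val)
    (hfinj.comp Subtype.val_injective) hrange
  refine ⟨T, isBaseChange_of_hom (mulTensor_bijective_of_isComplement' hc hE hF) S₂ T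
    (finrank_eq_finrank_of_isComplement' hc hE hF) (A.val.comp e.toAlgHom).toRingHom
    (fun k => (A.val.comp e.toAlgHom).commutes k) fun t z => ?_⟩
  exact (hact (e t) z).trans (he t z).symm

end HopfGaloisStructure

end

theorem theorem1p3 {K L : Type u} [Field K] [Field L] [Algebra K L]
    [FiniteDimensional K L] [IsGalois K L]
    (J G' : Subgroup Gal(L/K)) [J.Normal] (hc : J.IsComplement' G')
    (E F : IntermediateField K L)
    (hE : E = IntermediateField.fixedField G') (hF : F = IntermediateField.fixedField J) :
    -- `E/K` and `F/K` are Hopf Galois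
    (IsHopfGalois K E ∧ IsHopfGalois K F) ∧
    -- `L = EF` and `E ∩ F = K`
    (E ⊔ F = ⊤ ∧ E ⊓ F = ⊥) ∧
    -- `E` and `F` are linearly disjoint over `K`, and `L = E ⊗ F`
    (E.LinearDisjoint F ∧ Function.Bijective (mulTensor E F)) ∧
    ∀ (S₁ : HopfGaloisStructure.{w₁} K E) (S₂ : HopfGaloisStructure.{w₂} E L),
      -- there is a structure induced from `S₁` and `S₂`
      (∃ S : HopfGaloisStructure.{max w₁ w₂} K L, S.IsInduced hc S₁ S₂) ∧
      -- there is a structure on `F/K` whose base change to `E` is `S₂`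
      (∃ T : HopfGaloisStructure.{w₂} K F, T.IsBaseChange S₂ ∧
        -- and it is unique
        ∀ T' : HopfGaloisStructure.{w₄} K F, T'.IsBaseChange S₂ → T'.IsIso T) ∧
      -- the induced structure is the tensor product, acting by the Kronecker product
      ∀ (T : HopfGaloisStructure.{w₄} K F) (S : HopfGaloisStructure.{w₃} K L),
        T.IsBaseChange S₂ → S.IsInduced hc S₁ S₂ → S.IsTensorProduct S₁ T := by
  have hEF := mulTensor_bijective_of_isComplement' hc hE hF
  have hG := isGaloisGroup_of_eq_fixedField hE
  refine ⟨isHopfGalois_of_isComplement' hc hE hF, ⟨sup_eq_top_of_isComplement' hc hE hF,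
    inf_eq_bot_of_isComplement' hc hE hF⟩, ⟨linearDisjoint_of_isComplement' hc hE hF, hEF⟩,
    fun S₁ S₂ => ?_⟩
  obtain ⟨T, hT⟩ := S₂.exists_isBaseChange hc hE hF
  obtain ⟨N₁, h₁⟩ := S₁.exists_correspondsTo (IsCosetSystem.left hc hE)
  obtain ⟨N₂, h₂⟩ := S₂.exists_correspondsTo (IsCosetSystem.regular E L G')
  refine ⟨⟨HopfGaloisStructure.tensorProduct hEF S₁ T, N₁, N₂, h₁, h₂,
    HopfGaloisStructure.tensorProduct_correspondsTo hc hE hF hEF h₁ h₂ hT⟩,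
    ⟨T, hT, fun T' hT' => hT.isIso hEF hT'⟩, ?_⟩
  -- The permutation groups are now those that witness that `S` is induced, and `T` is any structure
  -- with base change `S₂`.
  rintro T S hT ⟨N₁, N₂, h₁, h₂, hS⟩
  exact HopfGaloisStructure.isTensorProduct_of_isIso hEF S₁ T
    ((HopfGaloisStructure.tensorProduct_correspondsTo hc hE hF hEF h₁ h₂ hT).isIso
      (IsCosetSystem.regular K L Gal(L/K)) hS)
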